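/- **Theorem 3.8 (Wick formula of type D).** Let $H$ be a complex Hilbert space with inner product $\langle\cdot,\cdot\rangle$, linear in the second and antilinear in the first argument, let $x\mapsto\overline{x}$ be a selfadjoint involution on $H$ (a bounded linear selfadjoint operator whose square is the identity), and let $q\in(-1,1)$. *Fock space.* Let $D(n)$ be the subgroup of the permutations of $\{\pm1,\dots,\pm n\}$ generated by $\pi_i=(i,i+1)(-i,-i-1)$, $1\le i\le n-1$, and $\widehat\pi_{n-1}=\overline\pi_n\pi_{n-1}\overline\pi_n$ with $\overline\pi_n=(n,-n)$ (no generators if $n\le1$), and let $\ell(\sigma)$ be the least number of generators whose product is $\sigma$. $D(n)$ acts linearly on $H^{\otimes n}$: $\pi_i$ exchanges the $i$-th and $(i+1)$-st tensor factors, and $\widehat\pi_{n-1}(x_1\otimes\cdots\otimes x_n)=x_1\otimes\cdots\otimes x_{n-2}\otimes\overline{x}_n\otimes\overline{x}_{n-1}$. On the algebraic full Fock space $\mathcal F=\bigoplus_{n\ge0}H^{\otimes n}$, $H^{\otimes0}=\mathbb C\Omega$, let $\langle\cdot,\cdot\rangle_0$ be the usual inner product, given by $\langle x_1\otimes\cdots\otimes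 x_m,y_1\otimes\cdots\otimes y_n\rangle_0=\delta_{m,n}\prod_i\langle x_i,y_i\rangle$ and $\|\Omega\|_0=1$, and put $\langle f,g\rangle_q=\langle f,\widehat P_q\,g\rangle_0$, where $\widehat P_q=\sum_{\sigma\in D(n)}q^{\ell(\sigma)}\sigma$ on $H^{\otimes n}$ (with $0^0=1$). Let $d_q^*(x)$ be the creation operator $d_q^*(x)\Omega=x$, $d_q^*(x)(x_1\otimes\cdots\otimes x_n)=x\otimes x_1\otimes\cdots\otimes x_n$, let $d_q(x)$ be its adjoint with respect to $\langle\cdot,\cdot\rangle_q$ (which exists as a linear operator on $\mathcal F$), and let $G_q(x)=d_q(x)+d_q^*(x)$. *Partitions.* For a partition $\pi$ of $[n]=\{1,\dots,n\}$ into pairs and blocks $V,W\in\pi$: $W$ covers $V$ if $\min W<\min V$ and $\max V<\max W$; $W$ crosses $V$ from the left if $\min W<\min V<\max W<\max V$; $W$ is on the right of $V$ if $\min V<\min W$. Let $\mathrm{Cr}(\pi)$ be the number of pairs $(V,W)$ of blocks such that $W$ crosses $V$ from the left. For a coloring $f:\pi\to\{1,-1\}$, let $\mathrm{cnp}(\pi,f)$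 be the number of pairs $(V,W)$ of blocks such that $f(V)=-1$ and $W$ covers $V$. Let $\mathcal P^D_2(n)$ be the set of pair partitions of type D, i.e. of all such $(\pi,f)$ for which every block $V$ that is neither covered nor crossed from the left by any block has color $f(V)=(-1)^{r(V)}$, where $r(V)$ is the number of blocks of color $-1$ on the right of $V$. For $\epsilon\in\{1,*\}^n$ let $\mathcal P^D_{2;\epsilon}(n)$ be the set of $(\pi,f)\in\mathcal P^D_2(n)$ with $\epsilon(i)=1$ and $\epsilon(j)=*$ for every block $\{i<j\}$ of $\pi$. An empty sum is $0$. Let $n\ge0$, $x_1,\dots,x_n\in H$ and $\epsilon\in\{1,*\}^n$. Write $d_q^{1}(x)=d_q(x)$. Then (1) $\displaystyle\langle\Omega,d_q^{\epsilon(1)}(x_1)\cdots d_q^{\epsilon(n)}(x_n)\Omega\rangle_q=\sum_{(\pi,f)\in\mathcal P^D_{2;\epsilon}(n)}q^{\mathrm{Cr}(\pi)+2\,\mathrm{cnp}(\pi,f)}\prod_{\substack{\{i<j\}\in\pi\\ f(\{i<j\})=1}}\langle x_i,x_j\rangle\prod_{\substack{\{i<j\}\in\pi\\ f(\{i<j\})=-1}}\langle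 x_i,\overline{x}_j\rangle;$ (2) $\displaystyle\langle\Omega,G_q(x_1)\cdots G_q(x_n)\Omega\rangle_q=\sum_{(\pi,f)\in\mathcal P^D_2(n)}q^{\mathrm{Cr}(\pi)+2\,\mathrm{cnp}(\pi,f)}\prod_{\substack{\{i<j\}\in\pi\\ f(\{i<j\})=1}}\langle x_i,x_j\rangle\prod_{\substack{\{i<j\}\in\pi\\ f(\{i<j\})=-1}}\langle x_i,\overline{x}_j\rangle.$ -/

import Mathlib

open scoped TensorProduct DirectSum ComplexConjugate

noncomputable section

namespace TypeD

/-! ### Coxeter groups of type B and D -/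

/-- The signed points `±1, …, ±n`: the pair `(k, s)` stands for `s * (k + 1)`. -/
abbrev SPoint (n : ℕ) : Type := Fin n × ℤˣ

/-- The Coxeter group of type B: the permutations `σ` of `{±1, …, ±n}` with `σ (-k) = -σ k`. -/
def GroupB (n : ℕ) : Subgroup (Equiv.Perm (SPoint n)) where
  carrier := {σ | ∀ k s, σ (k, -s) = ((σ (k, s)).1, -(σ (k, s)).2)}
  one_mem' := by intro k s; rfl
  mul_mem' := by
    intro σ τ hσ hτ k s
    simp only [Equiv.Perm.mul_apply]
    rw [hτ k s, hσ]
  inv_mem' := by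
    intro σ hσ k s
    rw [Equiv.Perm.inv_eq_iff_eq, hσ]
    simp

/-- The permutation of `{1, …, n}` obtained from a signed permutation by forgetting signs. -/
def absPerm {n : ℕ} (σ : GroupB n) : Equiv.Perm (Fin n) where
  toFun k := (σ.1 (k, 1)).1
  invFun k := (σ.1⁻¹ (k, 1)).1
  left_inv k := by
    have hi : ∀ p, σ.1⁻¹ (σ.1 p) = p := σ.1.symm_apply_apply
    rcases Int.units_eq_one_or (σ.1 (k, 1)).2 with h | h
    · have e : ((σ.1 (k, 1)).1, (1 : ℤˣ)) = σ.1 (k, 1) := Prod.ext rfl h.symm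
      simp only [e, hi]
    · have e : ((σ.1 (k, 1)).1, (1 : ℤˣ)) = σ.1 (k, -1) := by rw [σ.2 k 1, h]; simp
      simp only [e, hi]
  right_inv k := by
    have hi : ∀ p, σ.1 (σ.1⁻¹ p) = p := σ.1.apply_symm_apply
    have hm : ∀ k s, σ.1⁻¹ (k, -s) = ((σ.1⁻¹ (k, s)).1, -(σ.1⁻¹ (k, s)).2) := (σ⁻¹).2
    rcases Int.units_eq_one_or (σ.1⁻¹ (k, 1)).2 with h | h
    · have e : ((σ.1⁻¹ (k, 1)).1, (1 : ℤˣ)) = σ.1⁻¹ (k, 1) := Prod.ext rfl h.symm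
      simp only [e, hi]
    · have e : ((σ.1⁻¹ (k, 1)).1, (1 : ℤˣ)) = σ.1⁻¹ (k, -1) := by rw [hm k 1, h]; simp
      simp only [e, hi]

/-- The element `(i, j)(-i, -j)` of the group of type B. -/
def transp {n : ℕ} (i j : Fin n) : GroupB n :=
  ⟨(Equiv.swap i j).prodCongr (Equiv.refl ℤˣ), by intro k s; rfl⟩

/-- The element `(i, -i)` of the group of type B. -/
def signChange {n : ℕ} (i : Fin n) : GroupB n :=
  ⟨Function.Involutive.toPerm (fun p : SPoint n => (p.1, if p.1 = i then -p.2 else p.2))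
      (by rintro ⟨k, s⟩; by_cases h : k = i <;> simp [h]),
    by intro k s; by_cases h : k = i <;> simp [Function.Involutive.toPerm, h]⟩

/-- The generators `π_1, …, π_{n-1}` (adjacent transpositions) and
`π̂_{n-1} = (n, -n) π_{n-1} (n, -n)` of the group of type D; none if `n ≤ 1`. -/
def gens (n : ℕ) : Set (GroupB n) :=
  {g | ∃ (i : ℕ) (h : i + 1 < n), g = transp ⟨i, by omega⟩ ⟨i + 1, h⟩} ∪
  {g | ∃ h : 1 < n, g = signChange ⟨n - 1, by omega⟩ *
      transp ⟨n - 2, by omega⟩ ⟨n - 1, by omega⟩ * signChange ⟨n - 1, by omega⟩}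

/-- The Coxeter group of type D. -/
def GroupD (n : ℕ) : Subgroup (GroupB n) := Subgroup.closure (gens n)

/-- The length function: the least `k` such that `σ` is a product of `k` generators. -/
def length {n : ℕ} (σ : GroupB n) : ℕ :=
  sInf {k | ∃ w : List (GroupB n), (∀ g ∈ w, g ∈ gens n) ∧ w.prod = σ ∧ w.length = k}

/-! ### The Fock space -/

variable {H : Type*} [NormedAddCommGroup H] [InnerProductSpace ℂ H]

/-- The action of a signed permutation on `H^{⊗ n}`: the `j`-th tensor factor of
`σ (x_1 ⊗ ⋯ ⊗ x_n)` is `x_{σ⁻¹ j}`, where `x_{-k}` means `bar x_k`. -/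
def act (bar : H →L[ℂ] H) {n : ℕ} (σ : GroupB n) : (⨂[ℂ]^n H) →ₗ[ℂ] (⨂[ℂ]^n H) :=
  (PiTensorProduct.map fun j : Fin n =>
      if (σ.1⁻¹ (j, 1)).2 = 1 then (LinearMap.id : H →ₗ[ℂ] H) else (bar : H →ₗ[ℂ] H)) ∘ₗ
    (PiTensorProduct.reindex ℂ (fun _ : Fin n => H) (absPerm σ)).toLinearMap

theorem act_tprod (bar : H →L[ℂ] H) {n : ℕ} (σ : GroupB n) (x : Fin n → H) :
    act bar σ (PiTensorProduct.tprod ℂ x) = PiTensorProduct.tprod ℂ fun j =>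
      if (σ.1⁻¹ (j, 1)).2 = 1 then x (σ.1⁻¹ (j, 1)).1 else bar (x (σ.1⁻¹ (j, 1)).1) := by
  have h : PiTensorProduct.reindex ℂ (fun _ : Fin n => H) (absPerm σ)
      (PiTensorProduct.tprod ℂ x) =
      PiTensorProduct.tprod ℂ fun j => x ((absPerm σ).symm j) :=
    PiTensorProduct.reindex_tprod _ _
  rw [act, LinearMap.comp_apply, LinearEquiv.coe_coe, h, PiTensorProduct.map_tprod]
  congr 1
  funext j
  split_ifs <;> rfl

open scoped Classical in
/-- The symmetrizer of type D on `H^{⊗ n}`. -/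
def symmetrizer (q : ℝ) (bar : H →L[ℂ] H) (n : ℕ) : (⨂[ℂ]^n H) →ₗ[ℂ] (⨂[ℂ]^n H) :=
  ∑ σ : GroupD n, ((q : ℂ) ^ length σ.1) • act bar σ.1

variable (H) in
/-- The algebraic full Fock space over `H`. -/
abbrev Fock : Type _ := ⨁ n : ℕ, ⨂[ℂ]^n H

/-- The symmetrizer of type D on the full Fock space. -/
def symmetrizerFock (q : ℝ) (bar : H →L[ℂ] H) : Fock H →ₗ[ℂ] Fock H :=
  DirectSum.lmap (symmetrizer q bar)

variable (H) in
/-- Auxiliary: the inner product of `H^{⊗ n}` with its two arguments exchanged. -/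
def tensorInnerFlip (n : ℕ) : (⨂[ℂ]^n H) →ₗ[ℂ] (⨂[ℂ]^n H) →ₗ⋆[ℂ] ℂ :=
  PiTensorProduct.lift
    { toFun := fun y => (starLinearEquiv ℂ (A := ℂ)).toLinearMap.comp
        (TensorPower.multilinearMapToDual ℂ H n fun i => innerₛₗ ℂ (y i))
      map_update_add' := by
        intro _ y i a b
        have key : ∀ c : H, (fun j => innerₛₗ ℂ (Function.update y i c j)) =
            Function.update (fun j => innerₛₗ ℂ (y j)) i (innerₛₗ ℂ c) := by
          intro c; funext j
          by_cases h : j = i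
          · subst h; simp
          · simp [h]
        rw [key, key, key, map_add, MultilinearMap.map_update_add, LinearMap.comp_add]
      map_update_smul' := by
        intro _ y i c a
        have key : ∀ c : H, (fun j => innerₛₗ ℂ (Function.update y i c j)) =
            Function.update (fun j => innerₛₗ ℂ (y j)) i (innerₛₗ ℂ c) := by
          intro c; funext j
          by_cases h : j = i
          · subst h; simp
          · simp [h]
        rw [key, key, LinearMap.map_smulₛₗ, MultilinearMap.map_update_smul]
        ext z
        simp }

variable (H) in
/-- The inner product `⟨·,·⟩_0` on `H^{⊗ n}`, conjugate linear in the first argument. -/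
def tensorInner (n : ℕ) : (⨂[ℂ]^n H) →ₗ⋆[ℂ] (⨂[ℂ]^n H) →ₗ[ℂ] ℂ :=
  (tensorInnerFlip H n).flip

theorem tensorInner_tprod {n : ℕ} (x y : Fin n → H) :
    tensorInner H n (PiTensorProduct.tprod ℂ x) (PiTensorProduct.tprod ℂ y) =
      ∏ i, inner ℂ (x i) (y i) := by
  simp [tensorInner, tensorInnerFlip]

/-- The inner product `⟨·,·⟩_0` on the full Fock space: the summands `H^{⊗ n}` are mutually
orthogonal. -/
def innerZero (f g : Fock H) : ℂ :=
  DirectSum.toModule ℂ ℕ ℂ (fun n => tensorInner H n (f n)) g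

/-- The deformed inner product `⟨f, g⟩_q = ⟨f, P_q g⟩_0`. -/
def innerQ (q : ℝ) (bar : H →L[ℂ] H) (f g : Fock H) : ℂ :=
  innerZero f (symmetrizerFock q bar g)

variable (H) in
/-- The vacuum vector. -/
def vacuum : Fock H :=
  DirectSum.lof ℂ ℕ (fun n => ⨂[ℂ]^n H) 0 (PiTensorProduct.tprod ℂ fun i : Fin 0 => i.elim0)

/-- The map `x_1 ⊗ ⋯ ⊗ x_n ↦ x ⊗ x_1 ⊗ ⋯ ⊗ x_n`. -/
def tensorCons (x : H) (n : ℕ) : (⨂[ℂ]^n H) →ₗ[ℂ] (⨂[ℂ]^(n + 1) H) :=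
  PiTensorProduct.lift
    ((PiTensorProduct.tprod ℂ : MultilinearMap ℂ (fun _ : Fin (n + 1) => H) _).curryLeft x)

theorem tensorCons_tprod (x : H) {n : ℕ} (y : Fin n → H) :
    tensorCons x n (PiTensorProduct.tprod ℂ y) =
      PiTensorProduct.tprod ℂ (Fin.cons x y : Fin (n + 1) → H) := by
  simp [tensorCons]

/-- The creation operator `d_q^*(x) = l^*(x)`. -/
def creation (x : H) : Module.End ℂ (Fock H) :=
  DirectSum.toModule ℂ ℕ (Fock H) fun n =>
    DirectSum.lof ℂ ℕ (fun n => ⨂[ℂ]^n H) (n + 1) ∘ₗ tensorCons x n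

/-- `T` is an adjoint of `S` with respect to the deformed inner product. -/
def IsAdjointQ (q : ℝ) (bar : H →L[ℂ] H) (T S : Module.End ℂ (Fock H)) : Prop :=
  ∀ f g : Fock H, innerQ q bar (T f) g = innerQ q bar f (S g)

/-- The annihilation operator `d_q(x)`: the adjoint of `d_q^*(x)` with respect to the deformed
inner product. -/
def annihilation (q : ℝ) (bar : H →L[ℂ] H) (x : H) : Module.End ℂ (Fock H) :=
  Classical.epsilon fun T => IsAdjointQ q bar T (creation x)

/-- The operator `d_q^ε(x)` with `ε ∈ {1, *}`; `true` stands for `*` (creation) and `false`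
for `1` (annihilation). -/
def dOp (q : ℝ) (bar : H →L[ℂ] H) (ε : Bool) (x : H) : Module.End ℂ (Fock H) :=
  if ε = true then creation x else annihilation q bar x

/-- The Gaussian operator `G_q(x) = d_q(x) + d_q^*(x)`. -/
def gaussian (q : ℝ) (bar : H →L[ℂ] H) (x : H) : Module.End ℂ (Fock H) :=
  annihilation q bar x + creation x

/-! ### Coloured partitions of type D -/

/-- Set partitions of `[n]`, with the point `k` of `[n]` written as the element `k - 1` of
`Fin n`. -/
abbrev SetPartition (n : ℕ) : Type := Finpartition (Finset.univ : Finset (Fin n))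

/-- Coloured set partitions `(π, f)`: `f` assigns `1` or `-1` to every block of `π`. -/
abbrev ColoredPartition (n : ℕ) : Type :=
  Σ π : SetPartition n, ({V : Finset (Fin n) // V ∈ π.parts} → ℤˣ)

section Statistics

variable {n : ℕ}

/-- `B` is on the right of `A`. -/
def RightOf (B A : Finset (Fin n)) : Prop := A.min < B.min

/-- `A` covers `B`. -/
def Covers (A B : Finset (Fin n)) : Prop := ∃ i ∈ A, ∃ j ∈ A, ∀ k ∈ B, i < k ∧ k < j

/-- `W` crosses `V` from the left. -/
def LeftCrosses (W V : Finset (Fin n)) : Prop :=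
  ∃ i ∈ V, ∃ j ∈ V, ∃ k ∈ W, ∃ l ∈ W, k < i ∧ i < l ∧ l < j

open scoped Classical in
/-- The pair blocks of `π`. -/
def pairs (π : SetPartition n) : Finset (Finset (Fin n)) := {V ∈ π.parts | V.card = 2}

open scoped Classical in
/-- The singletons of `π`. -/
def sing (π : SetPartition n) : Finset (Finset (Fin n)) := {V ∈ π.parts | V.card = 1}

open scoped Classical in
/-- The number of blocks covering `V`. -/
def cover (π : SetPartition n) (V : Finset (Fin n)) : ℕ :=
  Finset.card {W ∈ π.parts | Covers W V}

open scoped Classical in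
/-- The number of singletons on the right of `V`. -/
def sr (π : SetPartition n) (V : Finset (Fin n)) : ℕ :=
  Finset.card {S ∈ sing π | RightOf S V}

open scoped Classical in
/-- The number of left crossings of `V`. -/
def lcr (π : SetPartition n) (V : Finset (Fin n)) : ℕ :=
  Finset.card {W ∈ π.parts | LeftCrosses W V}

/-- The number of crossings of `π`. -/
def Cr (π : SetPartition n) : ℕ := ∑ V ∈ π.parts, lcr π V

open scoped Classical in
/-- The negative pairs of a coloured partition. -/
def negPairs (p : ColoredPartition n) : Finset {V : Finset (Fin n) // V ∈ p.1.parts} :=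
  {V | V.1.card = 2 ∧ p.2 V = -1}

/-- The number of negative pairs. -/
def np (p : ColoredPartition n) : ℕ := (negPairs p).card

open scoped Classical in
/-- The number of negative pairs on the right of `V`. -/
def npr (p : ColoredPartition n) (V : Finset (Fin n)) : ℕ :=
  Finset.card {W ∈ negPairs p | RightOf W.1 V}

open scoped Classical in
/-- The number of covered negative pairs, counting multiplicity of covers. -/
def cnp (p : ColoredPartition n) : ℕ :=
  Finset.card {VW ∈ negPairs p ×ˢ pairs p.1 | Covers VW.2 VW.1.1}

/-- Coloured partitions of type D with blocks of cardinality `1` or `2`. The colour of a pair `V`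
is forced by the colours of the pairs on its right if `sr V = lcr V = cover V = 0` and is free
otherwise; the rightmost singleton has colour `(-1)^np`, the other singletons have colour `1`. -/
structure IsTypeD (p : ColoredPartition n) : Prop where
  card_block : ∀ V ∈ p.1.parts, V.card = 1 ∨ V.card = 2
  color_pair : ∀ V : {V : Finset (Fin n) // V ∈ p.1.parts}, V.1.card = 2 →
    sr p.1 V = 0 → lcr p.1 V = 0 → cover p.1 V = 0 → p.2 V = (-1) ^ npr p V
  color_rightmost_singleton : ∀ S : {V : Finset (Fin n) // V ∈ p.1.parts}, S.1.card = 1 →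
    (∀ T ∈ sing p.1, ¬ RightOf T S) → p.2 S = (-1) ^ np p
  color_singleton : ∀ S : {V : Finset (Fin n) // V ∈ p.1.parts}, S.1.card = 1 →
    (∃ T ∈ sing p.1, RightOf T S) → p.2 S = 1

/-- `π` is `ε`-compatible (`true` stands for `*`, `false` for `1`): every pair `{i < j}` has
`ε i = 1` and `ε j = *`, every singleton `{s}` has `ε s = *`. -/
def Compatible (ε : Fin n → Bool) (π : SetPartition n) : Prop :=
  (∀ i j : Fin n, i < j → ({i, j} : Finset (Fin n)) ∈ π.parts → ε i = false ∧ ε j = true) ∧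
  ∀ s : Fin n, ({s} : Finset (Fin n)) ∈ π.parts → ε s = true

end Statistics

open scoped Classical in
/-- The pair partitions of `[n]` of type D. -/
def PD2 (n : ℕ) : Finset (ColoredPartition n) :=
  {p | IsTypeD p ∧ ∀ V ∈ p.1.parts, V.card = 2}

open scoped Classical in
/-- The `ε`-compatible pair partitions of `[n]` of type D. -/
def PD2eps {n : ℕ} (ε : Fin n → Bool) : Finset (ColoredPartition n) :=
  {p ∈ PD2 n | Compatible ε p.1}

/-- The least element of a block. -/
def left {n : ℕ} {π : SetPartition n} (V : {V : Finset (Fin n) // V ∈ π.parts}) : Fin n :=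
  V.1.min' (π.nonempty_of_mem_parts V.2)

/-- The greatest element of a block. -/
def right {n : ℕ} {π : SetPartition n} (V : {V : Finset (Fin n) // V ∈ π.parts}) : Fin n :=
  V.1.max' (π.nonempty_of_mem_parts V.2)

/-- The contribution of a coloured pair partition `(π, f)` to the moment of `x_1, …, x_n`:
`q^{Cr + 2 cnp}` times the product of `⟨x_i, x_j⟩` over the positive pairs `{i < j}` and of
`⟨x_i, bar x_j⟩` over the negative pairs. -/
def weight (q : ℝ) (bar : H →L[ℂ] H) {n : ℕ} (x : Fin n → H) (p : ColoredPartition n) : ℂ :=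
  (q : ℂ) ^ (Cr p.1 + 2 * cnp p) *
    (∏ V with p.2 V = 1, inner ℂ (x (left V)) (x (right V))) *
    ∏ V with p.2 V = -1, inner ℂ (x (left V)) (bar (x (right V)))

end TypeD

end

noncomputable section

namespace TypeD

/-! ### Inversions and the length function of the Coxeter group of type D -/

/-! The proof turns on a recursion for the symmetrizer. The length in the group of type D counts
inversions of type D (`length_eq_inversions`). An even signed permutation of rank `n + 1` amounts to
a place `k` and a sign `t` for its first entry, together with an even signed permutation of the
other `n` places, where `t` is compensated by the same sign at the last of those places. Inversions
add under this decomposition (`EvenSigned.inv_cons`), so the symmetrizer factors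
(`symmetrizer_succ_tprod`). Contracting the first tensor factor with `x` then gives an explicit
adjoint of creation (`annihFock`, `isAdjointQ_annihFock`): on `H^{⊗ (n + 1)}` it removes the factor
`x_k`, counted from `0`, either with coefficient `q^k ⟨x, x_k⟩`, or with coefficient `q^(2n - k) ⟨x,
bar x_k⟩` and then with a bar put on the last remaining factor. The operator `annihilation` is an
unspecified adjoint, but moments depend on adjointness only (`innerQ_prod_congr`).

Read the product of operators from right to left. The vectors obtained from the vacuum are
combinations of tensors of the `x_j` in increasing order of index, with a possible bar `b` on the
last factor (`stateVec`). Creation opens a right end. Annihilation joins its point to an open right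
end `j` with some colour `c`. The open right ends before `j` will belong to arcs crossing the new
one from the left, those after `j` to arcs covering it, and the power of `q` is exactly the number
of the former, plus twice the number of the latter if `c = -1` (`annihFock_stateVec`). The bar `b`
is the product of the colours of the arcs already made. When only one right end is open, `c = b` is
forced, and this is the colour condition of type D.

Induction on the number of operators still to be applied (`innerQ_take_prod_stateVec`) gives a sum
over coloured matchings, which `sum_matchings_eq` turns into a sum over coloured partitions. Both
formulas are treated at once: each point carries the set `E i` of the operators allowed there, a
singleton for (1) and both for (2). -/

/-- The height of a signed point: `1, …, n, -n, …, -1` have heights `n, …, 1, -1, …, -n`. -/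
def height {n : ℕ} (a : SPoint n) : ℤ := (a.2 : ℤ) * ((n : ℤ) - (a.1 : ℕ))

theorem height_neg {n : ℕ} (k : Fin n) (t : ℤˣ) : height (k, -t) = -height (k, t) := by
  simp [height]

theorem height_one {n : ℕ} (k : Fin n) : height (k, 1) = (n : ℤ) - (k : ℕ) := by
  simp [height]

theorem height_mul {n : ℕ} (k : Fin n) (t u : ℤˣ) : height (k, t * u) = t * height (k, u) := by
  simp [height, mul_assoc]

theorem height_pos_iff {n : ℕ} (k : Fin n) (t : ℤˣ) : 0 < height (k, t) ↔ t = 1 := by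
  have := k.2
  rcases Int.units_eq_one_or t with h | h
  · subst h; rw [height_one]; simp
  · subst h; rw [height_neg, height_one]
    simp only [show ((-1 : ℤˣ) = 1) ↔ False by decide, iff_false]; omega

theorem height_injective {n : ℕ} : Function.Injective (height (n := n)) := by
  rintro ⟨k, t⟩ ⟨l, u⟩ h
  have := k.2
  have := l.2
  rcases Int.units_eq_one_or t with rfl | rfl <;> rcases Int.units_eq_one_or u with rfl | rfl <;>
    simp only [height_one, height_neg] at h <;> first | (exfalso; omega) | skip
  all_goals
    have : k = l := by ext; omega
    rw [this]

/-- The number of roots among `e_i - e_j`, `e_i + e_j` that become negative when `e_i`, `e_j` are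
sent to vectors of heights `a`, `b`. -/
def pairInv (a b : ℤ) : ℕ := (if a < b then 1 else 0) + (if a + b < 0 then 1 else 0)

/-- Negating `b` exchanges the roots `e_i - e_j` and `e_i + e_j`. Hence the sign of an entry matters
only in its pairs with later entries, which is what makes all later sign changes at the last place
harmless. -/
theorem pairInv_neg_right (a b : ℤ) : pairInv a (-b) = pairInv a b := by
  unfold pairInv; split_ifs <;> omega

theorem pairInv_unit_mul_right (a b : ℤ) (t : ℤˣ) : pairInv a (t * b) = pairInv a b := by
  rcases Int.units_eq_one_or t with rfl | rfl <;> simp [pairInv_neg_right]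

/-- The number of inversions of type D of a sequence of heights. -/
def invCount {n : ℕ} (u : Fin n → ℤ) : ℕ :=
  ∑ a : Fin n × Fin n, if a.1 < a.2 then pairInv (u a.1) (u a.2) else 0

/-- An adjacent transposition preserves the relative order of every pair of places except `k`, `l`
themselves. The identity is additive to avoid subtraction in `ℕ`. -/
theorem invCount_comp_swap {n : ℕ} (u : Fin n → ℤ) {k l : Fin n} (hkl : (l : ℕ) = k + 1) :
    invCount (fun i => u (Equiv.swap k l i)) + pairInv (u k) (u l) =
      invCount u + pairInv (u l) (u k) := by
  set e := Equiv.swap k l with he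
  have h1 : invCount (fun i => u (e i)) =
      ∑ a : Fin n × Fin n, if e a.1 < e a.2 then pairInv (u a.1) (u a.2) else 0 := by
    rw [← Equiv.sum_comp (e.prodCongr e)]
    unfold invCount
    refine Finset.sum_congr rfl fun a _ => ?_
    simp [he]
  -- Each correction term is written as a sum over all pairs with one nonzero summand, so that the
  -- identity can be checked pair by pair.
  have h2 : ∀ b : Fin n × Fin n, ∀ c : ℕ, (∑ a : Fin n × Fin n, if a = b then c else 0) = c := by
    intro b c; simp
  rw [h1, ← h2 (k, l) (pairInv (u k) (u l)), ← h2 (l, k) (pairInv (u l) (u k)), invCount,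
    ← Finset.sum_add_distrib, ← Finset.sum_add_distrib]
  refine Finset.sum_congr rfl ?_
  rintro ⟨i, j⟩ -
  have hne : k ≠ l := by intro h; rw [h] at hkl; omega
  by_cases hij : i = k ∧ j = l
  · obtain ⟨rfl, rfl⟩ := hij
    have h3 : ¬ (j < i) := by rw [Fin.lt_def]; omega
    have h4 : i < j := by rw [Fin.lt_def]; omega
    simp [he, h3, h4, hne]
  by_cases hij' : i = l ∧ j = k
  · obtain ⟨rfl, rfl⟩ := hij'
    have h3 : ¬ (i < j) := by rw [Fin.lt_def]; omega
    have h4 : j < i := by rw [Fin.lt_def]; omega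
    simp [he, h3, h4, hne]
  have key : e i < e j ↔ i < j := by
    simp only [he, Equiv.swap_apply_def, Fin.lt_def, Fin.ext_iff] at *
    split_ifs <;> omega
  simp only [key, Prod.mk.injEq, hij, hij', if_false]

/-- Every pair other than the last one has its first entry before `k`, where `u` and `v` agree, and
the sign of its second entry is irrelevant. -/
theorem invCount_congr_abs {n : ℕ} (u v : Fin n → ℤ) {k l : Fin n} (hk : (k : ℕ) + 2 = n)
    (hl : (l : ℕ) + 1 = n) (huv : ∀ i, v i = u i ∨ v i = -u i) (h : ∀ i < k, v i = u i) :
    invCount v + pairInv (u k) (u l) = invCount u + pairInv (v k) (v l) := by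
  have h2 : ∀ b : Fin n × Fin n, ∀ c : ℕ, (∑ a : Fin n × Fin n, if a = b then c else 0) = c := by
    intro b c; simp
  rw [← h2 (k, l) (pairInv (u k) (u l)), ← h2 (k, l) (pairInv (v k) (v l)), invCount, invCount,
    ← Finset.sum_add_distrib, ← Finset.sum_add_distrib]
  refine Finset.sum_congr rfl ?_
  rintro ⟨i, j⟩ -
  have hkl : k < l := by rw [Fin.lt_def]; omega
  by_cases hij : i = k ∧ j = l
  · obtain ⟨rfl, rfl⟩ := hij
    simp [hkl, add_comm]
  simp only [Prod.mk.injEq, hij, if_false, add_zero]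
  by_cases hlt : i < j
  · have hik : i < k := by
      simp only [Fin.lt_def, Fin.ext_iff] at *; omega
    rw [if_pos hlt, if_pos hlt, h i hik]
    rcases huv j with e | e <;> rw [e]
    rw [pairInv_neg_right]
  · simp [hlt]

/-- The heights of the images of `1, …, n`. -/
def heights {n : ℕ} (σ : GroupB n) (i : Fin n) : ℤ := height (σ.1 (i, 1))

/-- The number of positive roots of type D made negative by a signed permutation. -/
def inversions {n : ℕ} (σ : GroupB n) : ℕ := invCount (heights σ)

theorem height_apply_neg {n : ℕ} (σ : GroupB n) (i : Fin n) :
    height (σ.1 (i, -1)) = -heights σ i := by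
  rw [σ.2 i 1, height_neg]; rfl

theorem heights_mul_transp {n : ℕ} (σ : GroupB n) (k l : Fin n) :
    heights (σ * transp k l) = fun i => heights σ (Equiv.swap k l i) := by
  funext i; rfl

theorem hat_apply {n : ℕ} {k l : Fin n} (hkl : k ≠ l) (i : Fin n) :
    (signChange l * transp k l * signChange l : GroupB n).1 (i, 1) =
      (Equiv.swap k l i, if i = k ∨ i = l then -1 else 1) := by
  have key : ∀ (m i : Fin n) (t : ℤˣ), (signChange m : GroupB n).1 (i, t) =
    (i, if i = m then -t else t) := fun _ _ _ => rfl
  have key2 : ∀ (i : Fin n) (t : ℤˣ), (transp k l : GroupB n).1 (i, t) =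
    (Equiv.swap k l i, t) := fun _ _ => rfl
  simp only [Subgroup.coe_mul, Equiv.Perm.mul_apply, key, key2]
  by_cases h1 : i = k
  · subst h1; simp [hkl]
  by_cases h2 : i = l
  · subst h2; simp [h1, hkl]
  · simp [h1, h2, Equiv.swap_apply_of_ne_of_ne h1 h2]

theorem heights_mul_hat {n : ℕ} (σ : GroupB n) {k l : Fin n} (hkl : k ≠ l) (i : Fin n) :
    heights (σ * (signChange l * transp k l * signChange l)) i =
      if i = k ∨ i = l then -heights σ (Equiv.swap k l i) else heights σ (Equiv.swap k l i) := by
  rw [heights, Subgroup.coe_mul, Equiv.Perm.mul_apply, hat_apply hkl]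
  split_ifs
  · rw [height_apply_neg]
  · rfl

theorem inversions_mul_transp {n : ℕ} (σ : GroupB n) {k l : Fin n} (hkl : (l : ℕ) = k + 1) :
    inversions (σ * transp k l) + pairInv (heights σ k) (heights σ l) =
      inversions σ + pairInv (heights σ l) (heights σ k) := by
  rw [inversions, heights_mul_transp, invCount_comp_swap _ hkl]; rfl

theorem inversions_mul_hat {n : ℕ} (σ : GroupB n) {k l : Fin n} (hk : (k : ℕ) + 2 = n)
    (hl : (l : ℕ) + 1 = n) :
    inversions (σ * (signChange l * transp k l * signChange l)) +
        pairInv (heights σ k) (heights σ l) =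
      inversions σ + pairInv (-heights σ l) (-heights σ k) := by
  have hne : k ≠ l := by intro h; rw [h] at hk; omega
  have h1 := invCount_comp_swap (heights σ) (k := k) (l := l) (by omega)
  have h2 := invCount_congr_abs (fun i => heights σ (Equiv.swap k l i))
    (heights (σ * (signChange l * transp k l * signChange l))) hk hl
    (by intro i; rw [heights_mul_hat σ hne]; split_ifs <;> simp)
    (by
      intro i hi
      rw [heights_mul_hat σ hne, if_neg]
      rintro (rfl | rfl)
      · exact lt_irrefl _ hi
      · rw [Fin.lt_def] at hi; omega)
  simp only [heights_mul_hat σ hne, Equiv.swap_apply_left, Equiv.swap_apply_right, true_or, or_true,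
    if_true] at h2
  simp only [inversions] at *
  omega

theorem mem_gens_cases {n : ℕ} {g : GroupB n} (hg : g ∈ gens n) :
    (∃ k l : Fin n, (l : ℕ) = k + 1 ∧ g = transp k l) ∨
    (∃ k l : Fin n, (k : ℕ) + 2 = n ∧ (l : ℕ) + 1 = n ∧
      g = signChange l * transp k l * signChange l) := by
  rcases hg with ⟨i, h, rfl⟩ | ⟨h, rfl⟩
  · exact Or.inl ⟨_, _, rfl, rfl⟩
  · exact Or.inr ⟨⟨n - 2, by omega⟩, ⟨n - 1, by omega⟩, by simp; omega, by simp; omega, rfl⟩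

theorem transp_mem_gens {n : ℕ} {k l : Fin n} (hkl : (l : ℕ) = k + 1) : transp k l ∈ gens n := by
  refine Or.inl ⟨k, by omega, ?_⟩
  congr 1; ext; exact hkl

theorem hat_mem_gens {n : ℕ} {k l : Fin n} (hk : (k : ℕ) + 2 = n) (hl : (l : ℕ) + 1 = n) :
    signChange l * transp k l * signChange l ∈ gens n := by
  have h1 : k = ⟨n - 2, by omega⟩ := by ext; simp; omega
  have h2 : l = ⟨n - 1, by omega⟩ := by ext; simp; omega
  exact Or.inr ⟨by omega, by congr⟩

theorem transp_mul_self {n : ℕ} (k l : Fin n) : (transp k l : GroupB n) * transp k l = 1 := by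
  ext ⟨i, t⟩ <;> simp [transp]

theorem signChange_mul_self {n : ℕ} (l : Fin n) : (signChange l : GroupB n) * signChange l = 1 := by
  ext ⟨i, t⟩
  · rfl
  · by_cases h : i = l <;> simp [signChange, Function.Involutive.toPerm, h]

theorem gens_mul_self {n : ℕ} {g : GroupB n} (hg : g ∈ gens n) : g * g = 1 := by
  rcases mem_gens_cases hg with ⟨k, l, _, rfl⟩ | ⟨k, l, _, _, rfl⟩
  · exact transp_mul_self k l
  · calc _ = signChange l * transp k l * (signChange l * signChange l) * transp k l *
          signChange l := by group
      _ = signChange l * (transp k l * transp k l) * signChange l := by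
          rw [signChange_mul_self]; group
      _ = 1 := by rw [transp_mul_self, mul_one, signChange_mul_self]

/-- Only the pair `k`, `l` is affected. A transposition changes the contribution of the root `e_k -
e_l` alone, the last generator that of `e_k + e_l` alone. -/
theorem inversions_mul_le {n : ℕ} (σ : GroupB n) {g : GroupB n} (hg : g ∈ gens n) :
    inversions (σ * g) ≤ inversions σ + 1 := by
  rcases mem_gens_cases hg with ⟨k, l, hkl, rfl⟩ | ⟨k, l, hk, hl, rfl⟩
  · have := inversions_mul_transp σ hkl
    have h2 : pairInv (heights σ l) (heights σ k) ≤ pairInv (heights σ k) (heights σ l) + 1 := by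
      unfold pairInv; split_ifs <;> omega
    omega
  · have := inversions_mul_hat σ hk hl
    have h2 : pairInv (-heights σ l) (-heights σ k) ≤
        pairInv (heights σ k) (heights σ l) + 1 := by
      unfold pairInv; split_ifs <;> omega
    omega

theorem inversions_one (n : ℕ) : inversions (1 : GroupB n) = 0 := by
  unfold inversions invCount
  refine Finset.sum_eq_zero ?_
  rintro ⟨i, j⟩ -
  have h : ∀ i : Fin n, heights 1 i = (n : ℤ) - (i : ℕ) := fun i => height_one i
  have := i.2
  have := j.2
  simp only [h, pairInv, Fin.lt_def]
  split_ifs <;> omega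

theorem inversions_prod_le {n : ℕ} (w : List (GroupB n)) (hw : ∀ g ∈ w, g ∈ gens n) :
    inversions w.prod ≤ w.length := by
  induction w using List.reverseRecOn with
  | nil => simp [inversions_one]
  | append_singleton w g ih =>
    have h1 := ih fun g hg => hw g (by simp [hg])
    have h2 := inversions_mul_le w.prod (hw g (by simp))
    simp only [List.prod_append, List.prod_singleton, List.length_append, List.length_singleton]
    omega

/-- The product of the signs of a signed permutation. -/
def signProd {n : ℕ} (σ : GroupB n) : ℤˣ := ∏ k, (σ.1 (k, 1)).2

theorem apply_eq {n : ℕ} (σ : GroupB n) (k : Fin n) (t : ℤˣ) :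
    σ.1 (k, t) = (absPerm σ k, (σ.1 (k, 1)).2 * t) := by
  rcases Int.units_eq_one_or t with rfl | rfl
  · rw [mul_one]; rfl
  · rw [σ.2 k 1, mul_neg, mul_one]; rfl

theorem signProd_mul {n : ℕ} (σ τ : GroupB n) : signProd (σ * τ) = signProd σ * signProd τ := by
  have h : ∀ k, ((σ * τ).1 (k, 1)).2 = (σ.1 (absPerm τ k, 1)).2 * (τ.1 (k, 1)).2 := by
    intro k
    rw [Subgroup.coe_mul, Equiv.Perm.mul_apply, apply_eq τ k 1, apply_eq σ, mul_one]
  simp only [signProd, h, Finset.prod_mul_distrib]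
  congr 1
  exact Equiv.prod_comp (absPerm τ) fun k => (σ.1 (k, 1)).2

theorem signProd_one (n : ℕ) : signProd (1 : GroupB n) = 1 := by
  simp [signProd]

theorem signProd_of_mem_gens {n : ℕ} {g : GroupB n} (hg : g ∈ gens n) : signProd g = 1 := by
  rcases mem_gens_cases hg with ⟨k, l, hkl, rfl⟩ | ⟨k, l, hk, hl, rfl⟩
  · exact Finset.prod_eq_one fun _ _ => rfl
  · rw [signProd_mul, signProd_mul, mul_right_comm, ← signProd_mul, signChange_mul_self,
      signProd_one, one_mul]
    exact Finset.prod_eq_one fun _ _ => rfl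

theorem signProd_of_mem {n : ℕ} {σ : GroupB n} (hσ : σ ∈ GroupD n) : signProd σ = 1 := by
  have : GroupD n ≤ (MonoidHom.mk ⟨signProd, signProd_one n⟩ signProd_mul).ker :=
    (Subgroup.closure_le _).2 fun g hg => signProd_of_mem_gens hg
  exact this hσ

/-- Without descents the heights decrease, and the sum of the last two is nonnegative, so all but
possibly the last are positive. The product of the signs then makes the last one positive too, and
an increasing permutation of `Fin n` is the identity. -/
theorem eq_one_of_no_descent {n : ℕ} (σ : GroupB n) (hs : signProd σ = 1)
    (h1 : ∀ k l : Fin n, (l : ℕ) = k + 1 → heights σ l ≤ heights σ k)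
    (h2 : ∀ k l : Fin n, (k : ℕ) + 2 = n → (l : ℕ) + 1 = n → 0 ≤ heights σ k + heights σ l) :
    σ = 1 := by
  have hinj : Function.Injective (heights σ) := by
    intro i j hij
    have := σ.1.injective (height_injective hij)
    simpa using this
  have hanti : StrictAnti (heights σ) := by
    cases n with
    | zero => intro i; exact i.elim0
    | succ m =>
      rw [Fin.strictAnti_iff_succ_lt]
      intro i
      refine lt_of_le_of_ne (h1 _ _ (by simp)) fun h => ?_
      have := congrArg Fin.val (hinj h)
      simp at this
  have hpos : ∀ i : Fin n, (i : ℕ) + 1 < n → (σ.1 (i, 1)).2 = 1 := by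
    intro i hi
    rw [← height_pos_iff (σ.1 (i, 1)).1]
    change 0 < heights σ i
    have a1 := h2 ⟨n - 2, by omega⟩ ⟨n - 1, by omega⟩ (by simp; omega) (by simp; omega)
    have a2 : heights σ ⟨n - 1, by omega⟩ < heights σ ⟨n - 2, by omega⟩ :=
      hanti (by rw [Fin.lt_def]; simp; omega)
    have a3 : heights σ ⟨n - 2, by omega⟩ ≤ heights σ i :=
      hanti.antitone (by rw [Fin.le_def]; change (i : ℕ) ≤ n - 2; omega)
    omega
  have hsign : ∀ i : Fin n, (σ.1 (i, 1)).2 = 1 := by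
    intro i
    by_cases hi : (i : ℕ) + 1 < n
    · exact hpos i hi
    · refine Eq.trans (Finset.prod_eq_single i (fun j _ hj => hpos j ?_) fun h => absurd (Finset.mem_univ i) h).symm hs
      have : (j : ℕ) ≠ i := fun h => hj (Fin.ext h)
      omega
  have hmono : StrictMono (absPerm σ) := by
    intro i j hij
    have := hanti hij
    have e : ∀ i, heights σ i = (n : ℤ) - (absPerm σ i : ℕ) := by
      intro i
      rw [heights, apply_eq, hsign, mul_one, height_one]
    rw [e, e] at this
    rw [Fin.lt_def]; omega
  have hid : (absPerm σ : Fin n → Fin n) = id :=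
    (hmono.range_inj strictMono_id).1 (by simp [(absPerm σ).surjective.range_eq])
  apply Subtype.ext
  ext1 ⟨k, t⟩
  rw [apply_eq, hsign, one_mul, hid]
  rfl

/-- Sorting: as long as there is a descent, the corresponding generator removes exactly one
inversion. With `inversions_prod_le` this computes the length, and it shows that `signProd` alone
detects membership in `GroupD`. -/
theorem exists_word {n : ℕ} (σ : GroupB n) (hs : signProd σ = 1) :
    ∃ w : List (GroupB n), (∀ g ∈ w, g ∈ gens n) ∧ w.prod = σ ∧ w.length = inversions σ := by
  induction hN : inversions σ using Nat.strong_induction_on generalizing σ with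
  | _ N ih =>
  have step : ∀ g ∈ gens n, inversions (σ * g) + 1 = N →
      ∃ w : List (GroupB n), (∀ g ∈ w, g ∈ gens n) ∧ w.prod = σ ∧ w.length = N := by
    intro g hg hlt
    obtain ⟨w, hw, hp, hlen⟩ := ih _ (by omega) (σ * g)
      (by rw [signProd_mul, hs, signProd_of_mem_gens hg, one_mul]) rfl
    refine ⟨w ++ [g], ?_, ?_, ?_⟩
    · intro g' hg'
      rcases List.mem_append.1 hg' with h | h
      · exact hw _ h
      · rw [List.mem_singleton.1 h]; exact hg
    · rw [List.prod_append, hp, List.prod_singleton, mul_assoc, gens_mul_self hg, mul_one]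
    · simp [hlen, hlt]
  by_cases h1 : ∀ k l : Fin n, (l : ℕ) = k + 1 → heights σ l ≤ heights σ k
  · by_cases h2 : ∀ k l : Fin n, (k : ℕ) + 2 = n → (l : ℕ) + 1 = n →
        0 ≤ heights σ k + heights σ l
    · obtain rfl := eq_one_of_no_descent σ hs h1 h2
      exact ⟨[], by simp, rfl, by rw [← hN, inversions_one]; rfl⟩
    · push Not at h2
      obtain ⟨k, l, hk, hl, h⟩ := h2
      refine step _ (hat_mem_gens hk hl) ?_
      have := inversions_mul_hat σ hk hl
      have h3 : pairInv (-heights σ l) (-heights σ k) + 1 =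
          pairInv (heights σ k) (heights σ l) := by
        unfold pairInv; split_ifs <;> omega
      omega
  · push Not at h1
    obtain ⟨k, l, hkl, h⟩ := h1
    refine step _ (transp_mem_gens hkl) ?_
    have := inversions_mul_transp σ hkl
    have h3 : pairInv (heights σ l) (heights σ k) + 1 =
        pairInv (heights σ k) (heights σ l) := by
      unfold pairInv; split_ifs <;> omega
    omega

theorem mem_GroupD_iff {n : ℕ} {σ : GroupB n} : σ ∈ GroupD n ↔ signProd σ = 1 := by
  refine ⟨signProd_of_mem, fun h => ?_⟩
  obtain ⟨w, hw, rfl, -⟩ := exists_word σ h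
  exact Subgroup.list_prod_mem _ fun g hg => Subgroup.subset_closure (hw g hg)

theorem length_eq_inversions {n : ℕ} {σ : GroupB n} (hσ : σ ∈ GroupD n) :
    length σ = inversions σ := by
  obtain ⟨w, hw⟩ := exists_word σ (signProd_of_mem hσ)
  refine le_antisymm (Nat.sInf_le ⟨w, hw⟩) (le_csInf ⟨_, w, hw⟩ ?_)
  rintro k ⟨w, h1, rfl, rfl⟩
  exact inversions_prod_le w h1

/-- The generators are involutions, so reversing a word gives the inverse. -/
theorem length_inv_le {n : ℕ} {σ : GroupB n} (hσ : σ ∈ GroupD n) : length σ⁻¹ ≤ length σ := by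
  obtain ⟨w, h1, h2, h3⟩ := exists_word σ (signProd_of_mem hσ)
  rw [length_eq_inversions hσ]
  refine Nat.sInf_le ⟨w.reverse, fun g hg => h1 g (List.mem_reverse.1 hg), ?_, by simp [h3]⟩
  rw [← h2, List.prod_inv_reverse]
  congr 2
  refine (List.map_id w).symm.trans (List.map_congr_left fun g hg => ?_)
  exact eq_inv_of_mul_eq_one_left (gens_mul_self (h1 g hg))

theorem length_inv {n : ℕ} {σ : GroupB n} (hσ : σ ∈ GroupD n) : length σ⁻¹ = length σ :=
  le_antisymm (length_inv_le hσ) (by simpa using length_inv_le (inv_mem hσ))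

/-! ### Factorization of the symmetrizer -/

/-- The signed permutation `k ↦ s_k p(k)`. -/
def signedPerm {n : ℕ} (p : Equiv.Perm (Fin n)) (s : Fin n → ℤˣ) : GroupB n :=
  ⟨{ toFun := fun a => (p a.1, s a.1 * a.2)
     invFun := fun a => (p.symm a.1, s (p.symm a.1) * a.2)
     left_inv := fun a => by simp [← mul_assoc]
     right_inv := fun a => by simp [← mul_assoc] },
    fun k t => by simp⟩

theorem signedPerm_apply {n : ℕ} (p : Equiv.Perm (Fin n)) (s : Fin n → ℤˣ) (a : SPoint n) :
    (signedPerm p s).1 a = (p a.1, s a.1 * a.2) := rfl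

theorem signProd_signedPerm {n : ℕ} (p : Equiv.Perm (Fin n)) (s : Fin n → ℤˣ) :
    signProd (signedPerm p s) = ∏ k, s k := by
  simp [signProd, signedPerm_apply]

/-- The signed permutations with an even number of signs. -/
abbrev EvenSigned (n : ℕ) : Type :=
  {a : Equiv.Perm (Fin n) × (Fin n → ℤˣ) // ∏ k, a.2 k = 1}

/-- The element of the group of type D attached to the inverse of an even signed permutation. -/
def EvenSigned.toGroupD {n : ℕ} (a : EvenSigned n) : GroupD n :=
  ⟨(signedPerm a.1.1 a.1.2)⁻¹,
    inv_mem (mem_GroupD_iff.2 ((signProd_signedPerm _ _).trans a.2))⟩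

theorem EvenSigned.toGroupD_bijective (n : ℕ) :
    Function.Bijective (EvenSigned.toGroupD (n := n)) := by
  constructor
  · rintro ⟨⟨p, s⟩, h⟩ ⟨⟨p', s'⟩, h'⟩ e
    have e1 : signedPerm p s = signedPerm p' s' := inv_injective (congrArg Subtype.val e)
    have e2 : ∀ k, (p k, s k) = (p' k, s' k) := by
      intro k
      have := congrArg (fun σ : GroupB n => σ.1 (k, 1)) e1
      simpa [signedPerm_apply] using this
    simp only [Subtype.mk.injEq, Prod.mk.injEq]
    exact ⟨Equiv.ext fun k => (Prod.ext_iff.1 (e2 k)).1, funext fun k => (Prod.ext_iff.1 (e2 k)).2⟩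
  · rintro ⟨σ, hσ⟩
    refine ⟨⟨⟨absPerm σ⁻¹, fun k => ((σ⁻¹).1 (k, 1)).2⟩, mem_GroupD_iff.1 (inv_mem hσ)⟩, ?_⟩
    apply Subtype.ext
    rw [EvenSigned.toGroupD, inv_eq_iff_eq_inv]
    apply Subtype.ext
    ext1 ⟨k, t⟩
    rw [apply_eq σ⁻¹ k t]
    rfl

/-- The exponent of an even signed permutation in the symmetrizer. -/
def EvenSigned.inv {n : ℕ} (a : EvenSigned n) : ℕ :=
  invCount fun i => height (a.1.1 i, a.1.2 i)

theorem EvenSigned.length_toGroupD {n : ℕ} (a : EvenSigned n) :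
    length a.toGroupD.1 = a.inv := by
  rw [← length_inv a.toGroupD.2, length_eq_inversions (inv_mem a.toGroupD.2)]
  simp only [EvenSigned.toGroupD, inv_inv, inversions, EvenSigned.inv]
  congr 1
  funext i
  simp [heights, signedPerm_apply]

variable {H : Type*} [NormedAddCommGroup H] [InnerProductSpace ℂ H]

/-- The identity for the sign `1`, the involution for the sign `-1`. -/
def twist (bar : H →L[ℂ] H) (t : ℤˣ) : H →ₗ[ℂ] H := if t = 1 then LinearMap.id else bar

theorem twist_one (bar : H →L[ℂ] H) (x : H) : twist bar 1 x = x := by simp [twist]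

theorem twist_neg_one (bar : H →L[ℂ] H) (x : H) : twist bar (-1) x = bar x := by
  simp [twist, show (-1 : ℤˣ) ≠ 1 by decide]

theorem twist_twist {bar : H →L[ℂ] H} (hbar : ∀ y, bar (bar y) = y) (t u : ℤˣ) (x : H) :
    twist bar t (twist bar u x) = twist bar (t * u) x := by
  rcases Int.units_eq_one_or t with rfl | rfl <;> rcases Int.units_eq_one_or u with rfl | rfl <;>
    simp [twist_one, twist_neg_one, hbar]

/-- `act` moves factors by `σ⁻¹`; indexing the group by inverses makes the permutation of the
vectors explicit, and `length_inv` keeps the exponent. -/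
theorem symmetrizer_tprod (q : ℝ) (bar : H →L[ℂ] H) (n : ℕ) (x : Fin n → H) :
    symmetrizer q bar n (PiTensorProduct.tprod ℂ x) = ∑ a : EvenSigned n, ((q : ℂ) ^ a.inv) •
      PiTensorProduct.tprod ℂ fun j => twist bar (a.1.2 j) (x (a.1.1 j)) := by
  classical
  rw [symmetrizer, LinearMap.sum_apply, ← (EvenSigned.toGroupD_bijective n).sum_comp]
  refine Finset.sum_congr rfl fun a _ => ?_
  rw [LinearMap.smul_apply, a.length_toGroupD, act_tprod]
  congr 3
  funext j
  have : (a.toGroupD.1).1⁻¹ (j, 1) = (a.1.1 j, a.1.2 j) := by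
    change (a.toGroupD.1)⁻¹.1 (j, 1) = _
    simp [EvenSigned.toGroupD, signedPerm_apply]
  rw [this]
  simp only [twist]
  split_ifs <;> rfl

/-- The permutation `0 ↦ k`, `j + 1 ↦ p(j)`, where `p` acts on the complement of `k`. -/
def permCons {n : ℕ} (k : Fin (n + 1)) (p : Equiv.Perm (Fin n)) : Equiv.Perm (Fin (n + 1)) :=
  (finSuccEquiv' 0).trans ((Equiv.optionCongr p).trans (finSuccEquiv' k).symm)

theorem permCons_zero {n : ℕ} (k : Fin (n + 1)) (p : Equiv.Perm (Fin n)) :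
    permCons k p 0 = k := by
  simp [permCons]

theorem permCons_succ {n : ℕ} (k : Fin (n + 1)) (p : Equiv.Perm (Fin n)) (j : Fin n) :
    permCons k p j.succ = k.succAbove (p j) := by
  have h : j.succ = (0 : Fin (n + 1)).succAbove j := by simp
  rw [h, permCons, Equiv.trans_apply, finSuccEquiv'_succAbove]
  simp

theorem permCons_injective {n : ℕ} {k k' : Fin (n + 1)} {p p' : Equiv.Perm (Fin n)}
    (h : permCons k p = permCons k' p') : k = k' ∧ p = p' := by
  obtain rfl : k = k' := by rw [← permCons_zero k p, h, permCons_zero]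
  refine ⟨rfl, Equiv.ext fun j => ?_⟩
  have : permCons k p j.succ = permCons k p' j.succ := by rw [h]
  rw [permCons_succ, permCons_succ] at this
  exact Fin.succAbove_right_injective this

theorem exists_permCons {n : ℕ} (r : Equiv.Perm (Fin (n + 1))) : ∃ k p, r = permCons k p := by
  have : Function.Bijective
      (fun a : Fin (n + 1) × Equiv.Perm (Fin n) => permCons a.1 a.2) := by
    rw [Fintype.bijective_iff_injective_and_card]
    refine ⟨fun a b h => Prod.ext_iff.2 (permCons_injective h), ?_⟩
    simp [Fintype.card_perm, Nat.factorial_succ]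
  obtain ⟨a, ha⟩ := this.2 r
  exact ⟨a.1, a.2, ha.symm⟩

/-- The sign `t` at the last place, `1` elsewhere. -/
def lastSign {n : ℕ} (t : ℤˣ) (j : Fin n) : ℤˣ := if (j : ℕ) + 1 = n then t else 1

theorem prod_lastSign {n : ℕ} (t : ℤˣ) (h : n = 0 → t = 1) : ∏ j : Fin n, lastSign t j = t := by
  cases n with
  | zero => simp [h rfl]
  | succ m =>
    rw [Fin.prod_univ_castSucc, Finset.prod_eq_one]
    · simp [lastSign]
    · intro j _
      have := j.2
      simp only [lastSign, Fin.val_castSucc]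
      rw [if_neg (by omega)]

/-- The minimal representatives of the cosets of the group of type D of rank `n` in that of rank
`n + 1`: a place and a sign. -/
abbrev Coset (n : ℕ) : Type := {a : Fin (n + 1) × ℤˣ // n = 0 → a.2 = 1}

/-- The length of a minimal coset representative. -/
def Coset.cost {n : ℕ} (c : Coset n) : ℕ :=
  if c.1.2 = 1 then (c.1.1 : ℕ) else 2 * n - c.1.1

/-- The product of a minimal coset representative and an even signed permutation. -/
def EvenSigned.cons {n : ℕ} (c : Coset n) (a : EvenSigned n) : EvenSigned (n + 1) :=
  ⟨(permCons c.1.1 a.1.1,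
    Fin.cons c.1.2 fun j => a.1.2 j * lastSign c.1.2 (a.1.1 j)), by
    -- The sign at the first place is cancelled by the equal sign put at the last place of the
    -- complement. For `n = 0` there is no such place, whence the condition in `Coset`.
    rw [Fin.prod_univ_succ]
    simp only [Fin.cons_zero, Fin.cons_succ, Finset.prod_mul_distrib, a.2, one_mul]
    rw [Equiv.prod_comp a.1.1 (lastSign c.1.2), prod_lastSign _ c.2, Int.units_mul_self]⟩

theorem EvenSigned.cons_bijective (n : ℕ) :
    Function.Bijective fun a : Coset n × EvenSigned n => EvenSigned.cons a.1 a.2 := by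
  constructor
  · rintro ⟨⟨⟨k, t⟩, hc⟩, ⟨⟨p, s⟩, ha⟩⟩ ⟨⟨⟨k', t'⟩, hc'⟩, ⟨⟨p', s'⟩, ha'⟩⟩ h
    simp only [EvenSigned.cons, Subtype.mk.injEq, Prod.mk.injEq] at h
    obtain ⟨h1, h2⟩ := h
    obtain ⟨rfl, rfl⟩ := permCons_injective h1
    obtain ⟨rfl, h3⟩ := Fin.cons_injective2 h2
    have : s = s' := by
      funext j
      exact mul_right_cancel (congrFun h3 j)
    simp [this]
  · rintro ⟨⟨r, s⟩, hs⟩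
    obtain ⟨k, p, rfl⟩ := exists_permCons r
    have h0 : n = 0 → s 0 = 1 := by
      rintro rfl
      simpa using hs
    have hs' : ∏ j : Fin n, (s j.succ * lastSign (s 0) (p j)) = 1 := by
      rw [Finset.prod_mul_distrib, Equiv.prod_comp p (lastSign (s 0)), prod_lastSign _ h0,
        mul_comm, ← Fin.prod_univ_succ]
      exact hs
    refine ⟨(⟨(k, s 0), h0⟩, ⟨(p, fun j => s j.succ * lastSign (s 0) (p j)), hs'⟩), ?_⟩
    apply Subtype.ext
    simp only [EvenSigned.cons, Prod.mk.injEq, true_and]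
    funext j
    refine Fin.cases ?_ (fun i => ?_) j
    · simp
    · simp [mul_assoc]

theorem invCount_succ {n : ℕ} (u : Fin (n + 1) → ℤ) :
    invCount u = (∑ j : Fin n, pairInv (u 0) (u j.succ)) + invCount fun j : Fin n => u j.succ := by
  unfold invCount
  rw [Fintype.sum_prod_type, Fin.sum_univ_succ, Fin.sum_univ_succ]
  simp only [lt_irrefl, if_false, Fin.succ_pos, if_true, zero_add, add_right_inj]
  rw [Fintype.sum_prod_type]
  refine Finset.sum_congr rfl fun i _ => ?_
  rw [Fin.sum_univ_succ]
  simp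

theorem succAbove_val {n : ℕ} (k : Fin (n + 1)) (i : Fin n) :
    (k.succAbove i : ℕ) = if (i : ℕ) < k then (i : ℕ) else i + 1 := by
  unfold Fin.succAbove
  simp only [Fin.lt_def, Fin.val_castSucc]
  split_ifs <;> rfl

theorem sum_ite_lt {n : ℕ} (k : ℕ) (hk : k ≤ n) :
    ∑ i : Fin n, (if (i : ℕ) < k then 1 else 0) = k := by
  rw [Fin.sum_univ_eq_sum_range (fun i => if i < k then 1 else 0) n, ← Finset.sum_filter]
  rw [show (Finset.range n).filter (fun i => i < k) = Finset.range k by ext i; simp; omega]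
  simp

/-- For sign `1`, exactly the `k` places before `k` give an inversion. For sign `-1`, all `n` other
places give one, and the `n - k` places after `k` a second one. -/
theorem sum_pairInv_coset {n : ℕ} (c : Coset n) :
    ∑ i : Fin n, pairInv (height c.1) (height (c.1.1.succAbove i, 1)) = c.cost := by
  obtain ⟨⟨k, t⟩, hc⟩ := c
  have hk : (k : ℕ) ≤ n := by omega
  rw [Coset.cost]
  simp only [height_one, succAbove_val]
  rcases Int.units_eq_one_or t with rfl | rfl
  · rw [if_pos rfl]
    refine Eq.trans ?_ (sum_ite_lt (n := n) k hk)
    refine Finset.sum_congr rfl fun i _ => ?_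
    have := i.2
    rw [height_one, pairInv]
    split_ifs <;> omega
  · rw [if_neg (by decide)]
    -- Once `k` is distributed over the places before `k`, every summand equals `2`.
    have h1 : (∑ i : Fin n, pairInv (height (k, -1))
        (((n + 1 : ℕ) : ℤ) - ((if (i : ℕ) < k then (i : ℕ) else i + 1 : ℕ) : ℤ))) + k = 2 * n := by
      refine (congrArg _ (sum_ite_lt (n := n) k hk).symm).trans ?_
      rw [← Finset.sum_add_distrib, Finset.sum_congr rfl (g := fun _ => 2)]
      · simp [mul_comm]
      · intro i _
        have := i.2
        rw [height_neg, height_one, pairInv]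
        split_ifs <;> omega
    omega

/-- Skipping `k` preserves the order of absolute heights. The extra sign affects only the entry of
least absolute height among those compared, for which exactly one of the two roots is inverted
whatever its sign. -/
theorem pairInv_height_succAbove {n : ℕ} (k : Fin (n + 1)) (t : ℤˣ) {i j : Fin n} (hij : i ≠ j)
    (s u v : ℤˣ) :
    pairInv (height (k.succAbove i, s * lastSign t i)) (height (k.succAbove j, v)) =
      pairInv (height (i, s)) (height (j, u)) := by
  have h1 : ∀ (m : ℕ) (l : Fin m) (w : ℤˣ), height (l, w) = w * height (l, 1) := by
    intro m l w; rw [← height_mul, mul_one]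
  rw [h1 _ _ v, h1 _ _ u, pairInv_unit_mul_right, pairInv_unit_mul_right]
  have hne : (i : ℕ) ≠ j := fun h => hij (Fin.ext h)
  have hi := i.2
  have hj := j.2
  have hs : s * lastSign t i = s ∨ ((i : ℕ) + 1 = n ∧ s * lastSign t i = -s) := by
    unfold lastSign
    split_ifs with h
    · rcases Int.units_eq_one_or t with rfl | rfl <;> simp [h]
    · simp
  have hsA := succAbove_val k i
  have hsB := succAbove_val k j
  generalize s * lastSign t i = w at hs
  rcases hs with rfl | ⟨hl, rfl⟩
  · rcases Int.units_eq_one_or w with rfl | rfl <;>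
    · simp only [height_neg, height_one, pairInv, hsA, hsB]
      split_ifs <;> omega
  · rcases Int.units_eq_one_or s with rfl | rfl <;>
    · simp only [height_neg, height_one, pairInv, hsA, hsB]
      split_ifs <;> omega

/-- Lengths add along minimal coset representatives: pairs containing the first place give the cost,
and the other pairs are unaffected by `c`. -/
theorem EvenSigned.inv_cons {n : ℕ} (c : Coset n) (a : EvenSigned n) :
    (EvenSigned.cons c a).inv = c.cost + a.inv := by
  rw [EvenSigned.inv, invCount_succ]
  simp only [EvenSigned.cons, permCons_zero, permCons_succ, Fin.cons_zero, Fin.cons_succ]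
  congr 1
  · rw [← sum_pairInv_coset]
    refine Eq.trans ?_ (Equiv.sum_comp a.1.1 _)
    refine Finset.sum_congr rfl fun j _ => ?_
    rw [← mul_one (a.1.2 j * _), height_mul, pairInv_unit_mul_right]
  · unfold EvenSigned.inv invCount
    refine Finset.sum_congr rfl ?_
    rintro ⟨i, j⟩ -
    by_cases h : i < j
    · rw [if_pos h, if_pos h]
      exact pairInv_height_succAbove _ _ (fun e => h.ne (a.1.1.injective e)) _ _ _
    · rw [if_neg h, if_neg h]

/-- Remove the entry at a place, and twist the new last entry. -/
def removeAt (bar : H →L[ℂ] H) {n : ℕ} (c : Coset n) (x : Fin (n + 1) → H) (j : Fin n) : H :=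
  twist bar (lastSign c.1.2 j) (x (c.1.1.succAbove j))

theorem symmetrizer_succ_tprod (q : ℝ) {bar : H →L[ℂ] H} (hbar : ∀ y, bar (bar y) = y) (n : ℕ)
    (x : Fin (n + 1) → H) :
    symmetrizer q bar (n + 1) (PiTensorProduct.tprod ℂ x) =
      ∑ c : Coset n, ((q : ℂ) ^ c.cost) • tensorCons (twist bar c.1.2 (x c.1.1)) n
        (symmetrizer q bar n (PiTensorProduct.tprod ℂ (removeAt bar c x))) := by
  rw [symmetrizer_tprod, ← (EvenSigned.cons_bijective n).sum_comp, Fintype.sum_prod_type]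
  refine Finset.sum_congr rfl fun c _ => ?_
  rw [symmetrizer_tprod, map_sum, Finset.smul_sum]
  refine Finset.sum_congr rfl fun a _ => ?_
  rw [map_smul, smul_smul, ← pow_add, EvenSigned.inv_cons, tensorCons_tprod]
  congr 2
  funext j
  refine Fin.cases ?_ (fun i => ?_) j
  · simp [EvenSigned.cons, permCons_zero]
  · simp [EvenSigned.cons, permCons_succ, removeAt, twist_twist hbar]

/-! ### The deformed inner product and the annihilation operators -/

theorem twist_symmetric {bar : H →L[ℂ] H} (hsym : ∀ x y, inner ℂ (bar x) y = inner ℂ x (bar y))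
    (t : ℤˣ) (x y : H) : inner ℂ (twist bar t x) y = inner ℂ x (twist bar t y) := by
  rcases Int.units_eq_one_or t with rfl | rfl <;> simp [twist_one, twist_neg_one, hsym]

theorem act_tprod_twist (bar : H →L[ℂ] H) {n : ℕ} (σ : GroupB n) (x : Fin n → H) :
    act bar σ (PiTensorProduct.tprod ℂ x) = PiTensorProduct.tprod ℂ fun j =>
      twist bar ((σ⁻¹).1 (j, 1)).2 (x (absPerm σ⁻¹ j)) := by
  rw [act_tprod]
  congr 1
  funext j
  simp only [twist]
  split_ifs with h1 h2 h2 <;> first | rfl | exact absurd h1 h2 | exact absurd h2 h1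

theorem tensorInner_act {bar : H →L[ℂ] H} (hsym : ∀ x y, inner ℂ (bar x) y = inner ℂ x (bar y))
    {n : ℕ} (σ : GroupB n) (f g : ⨂[ℂ]^n H) :
    tensorInner H n (act bar σ f) g = tensorInner H n f (act bar σ⁻¹ g) := by
  induction f using PiTensorProduct.induction_on with
  | add f f' h h' => simp only [map_add, LinearMap.add_apply, h, h']
  | smul_tprod r x =>
    induction g using PiTensorProduct.induction_on with
    | add g g' h h' => simp only [map_add, h, h']
    | smul_tprod s y =>
      simp only [LinearMap.map_smulₛₗ, LinearMap.smul_apply, map_smul]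
      congr 2
      rw [act_tprod_twist, act_tprod_twist, tensorInner_tprod, tensorInner_tprod,
        ← Equiv.prod_comp (absPerm σ)]
      refine Finset.prod_congr rfl fun i _ => ?_
      have h : (σ⁻¹).1 (σ.1 (i, 1)) = (i, 1) := σ.1.symm_apply_apply (i, 1)
      rw [apply_eq σ i 1, mul_one, apply_eq σ⁻¹] at h
      obtain ⟨h1, h2⟩ := Prod.ext_iff.1 h
      simp only at h1 h2
      rw [inv_inv, h1, twist_symmetric hsym, mul_eq_one_iff_eq_inv.1 h2, Int.units_inv_eq_self]

/-- The adjoint of `σ` is `σ⁻¹`, and the real weight `q ^ length σ` is the same for both. -/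
theorem tensorInner_symmetrizer (q : ℝ) {bar : H →L[ℂ] H}
    (hsym : ∀ x y, inner ℂ (bar x) y = inner ℂ x (bar y)) {n : ℕ} (f g : ⨂[ℂ]^n H) :
    tensorInner H n (symmetrizer q bar n f) g = tensorInner H n f (symmetrizer q bar n g) := by
  classical
  simp only [symmetrizer, LinearMap.sum_apply, map_sum, LinearMap.smul_apply,
    LinearMap.map_smulₛₗ, map_smul, tensorInner_act hsym]
  rw [← Equiv.sum_comp (Equiv.inv (GroupD n))]
  refine Finset.sum_congr rfl fun σ _ => ?_
  simp [length_inv σ.2]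

theorem tensorInner_conj {n : ℕ} (f g : ⨂[ℂ]^n H) :
    conj (tensorInner H n f g) = tensorInner H n g f := by
  induction f using PiTensorProduct.induction_on with
  | add f f' h h' => simp only [map_add, LinearMap.add_apply, h, h']
  | smul_tprod r x =>
    induction g using PiTensorProduct.induction_on with
    | add g g' h h' => simp only [map_add, LinearMap.add_apply, h, h']
    | smul_tprod s y =>
      simp only [LinearMap.map_smulₛₗ, LinearMap.smul_apply, map_smul, tensorInner_tprod,
        smul_eq_mul, map_mul, map_prod, inner_conj_symm, RingHomCompTriple.comp_apply]
      simp
      ring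

theorem innerZero_lof_right (f : Fock H) (n : ℕ) (b : ⨂[ℂ]^n H) :
    innerZero f (DirectSum.lof ℂ ℕ (fun n => ⨂[ℂ]^n H) n b) = tensorInner H n (f n) b := by
  rw [innerZero, DirectSum.toModule_lof]

theorem innerQ_lof_right (q : ℝ) (bar : H →L[ℂ] H) (f : Fock H) (n : ℕ) (b : ⨂[ℂ]^n H) :
    innerQ q bar f (DirectSum.lof ℂ ℕ (fun n => ⨂[ℂ]^n H) n b) =
      tensorInner H n (f n) (symmetrizer q bar n b) := by
  rw [innerQ, symmetrizerFock, DirectSum.lmap_lof, innerZero_lof_right]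

theorem innerQ_add_right (q : ℝ) (bar : H →L[ℂ] H) (f g g' : Fock H) :
    innerQ q bar f (g + g') = innerQ q bar f g + innerQ q bar f g' := by
  simp [innerQ, innerZero]

theorem innerQ_zero_right (q : ℝ) (bar : H →L[ℂ] H) (f : Fock H) :
    innerQ q bar f 0 = 0 := by
  simp [innerQ, innerZero]

theorem innerQ_smul_right (q : ℝ) (bar : H →L[ℂ] H) (c : ℂ) (f g : Fock H) :
    innerQ q bar f (c • g) = c * innerQ q bar f g := by
  simp [innerQ, innerZero]

theorem innerQ_add_left (q : ℝ) (bar : H →L[ℂ] H) (f f' g : Fock H) :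
    innerQ q bar (f + f') g = innerQ q bar f g + innerQ q bar f' g := by
  induction g using DirectSum.induction_on with
  | zero => simp [innerQ_zero_right]
  | of n b =>
    simp only [← DirectSum.lof_eq_of ℂ, innerQ_lof_right, DirectSum.add_apply, map_add,
      LinearMap.add_apply]
  | add g g' h h' => simp only [innerQ_add_right, h, h']; ring

theorem innerQ_zero_left (q : ℝ) (bar : H →L[ℂ] H) (g : Fock H) :
    innerQ q bar 0 g = 0 := by
  have := innerQ_add_left q bar 0 0 g
  simpa using this

theorem innerQ_conj (q : ℝ) {bar : H →L[ℂ] H}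
    (hsym : ∀ x y, inner ℂ (bar x) y = inner ℂ x (bar y)) (f g : Fock H) :
    conj (innerQ q bar f g) = innerQ q bar g f := by
  induction g using DirectSum.induction_on with
  | zero => simp [innerQ_zero_right, innerQ_zero_left]
  | add g g' h h' => simp only [innerQ_add_right, innerQ_add_left, map_add, h, h']
  | of n b =>
    induction f using DirectSum.induction_on with
    | zero => simp [innerQ_zero_right, innerQ_zero_left]
    | add f f' h h' => simp only [innerQ_add_right, innerQ_add_left, map_add, h, h']
    | of m a =>
      simp only [← DirectSum.lof_eq_of ℂ, innerQ_lof_right]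
      by_cases hmn : m = n
      · subst hmn
        rw [DirectSum.lof_apply, DirectSum.lof_apply, tensorInner_conj,
          tensorInner_symmetrizer q hsym]
      · rw [DirectSum.lof_eq_of, DirectSum.lof_eq_of, DirectSum.of_eq_of_ne _ _ _ (Ne.symm hmn),
          DirectSum.of_eq_of_ne _ _ _ hmn]
        simp

/-- The contraction `y_0 ⊗ ⋯ ⊗ y_n ↦ ⟨x, y_0⟩ y_1 ⊗ ⋯ ⊗ y_n`. -/
def contract (x : H) (n : ℕ) : (⨂[ℂ]^(n + 1) H) →ₗ[ℂ] (⨂[ℂ]^n H) :=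
  PiTensorProduct.lift (LinearMap.uncurryLeft
    ((innerₛₗ ℂ x).smulRight (PiTensorProduct.tprod ℂ : MultilinearMap ℂ (fun _ : Fin n => H) _)))

theorem contract_tprod (x : H) {n : ℕ} (y : Fin (n + 1) → H) :
    contract x n (PiTensorProduct.tprod ℂ y) =
      inner ℂ x (y 0) • PiTensorProduct.tprod ℂ (fun j : Fin n => y j.succ) := by
  simp [contract, Fin.tail_def]

theorem contract_tensorCons (x y : H) {n : ℕ} (f : ⨂[ℂ]^n H) :
    contract x n (tensorCons y n f) = inner ℂ x y • f := by
  induction f using PiTensorProduct.induction_on with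
  | add f f' h h' => simp only [map_add, smul_add, h, h']
  | smul_tprod r z =>
    simp only [map_smul, tensorCons_tprod, contract_tprod, Fin.cons_zero, Fin.cons_succ]
    rw [smul_comm]

theorem tensorInner_contract (x : H) {n : ℕ} (f : ⨂[ℂ]^(n + 1) H) (g : ⨂[ℂ]^n H) :
    tensorInner H n (contract x n f) g = tensorInner H (n + 1) f (tensorCons x n g) := by
  induction f using PiTensorProduct.induction_on with
  | add f f' h h' => simp only [map_add, LinearMap.add_apply, h, h']
  | smul_tprod r y =>
    induction g using PiTensorProduct.induction_on with
    | add g g' h h' => simp only [map_add, h, h']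
    | smul_tprod s z =>
      simp only [LinearMap.map_smulₛₗ, LinearMap.smul_apply, map_smul, tensorCons_tprod,
        contract_tprod, tensorInner_tprod, Fin.prod_univ_succ, Fin.cons_zero, Fin.cons_succ,
        inner_conj_symm, smul_eq_mul]

/-- The annihilation operator on `H^{⊗ (n + 1)}`. -/
def annih (q : ℝ) (bar : H →L[ℂ] H) (x : H) (n : ℕ) : (⨂[ℂ]^(n + 1) H) →ₗ[ℂ] (⨂[ℂ]^n H) :=
  contract x n ∘ₗ ∑ c : Coset n, ((q : ℂ) ^ c.cost) •
    act bar (signedPerm (permCons c.1.1 1) (Fin.cons c.1.2 (lastSign c.1.2)))⁻¹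

theorem annih_tprod (q : ℝ) (bar : H →L[ℂ] H) (x : H) {n : ℕ} (y : Fin (n + 1) → H) :
    annih q bar x n (PiTensorProduct.tprod ℂ y) = ∑ c : Coset n,
      ((q : ℂ) ^ c.cost * inner ℂ x (twist bar c.1.2 (y c.1.1))) •
        PiTensorProduct.tprod ℂ (removeAt bar c y) := by
  have key : ∀ c : Coset n, act bar
      (signedPerm (permCons c.1.1 1) (Fin.cons c.1.2 (lastSign c.1.2)))⁻¹
      (PiTensorProduct.tprod ℂ y) = PiTensorProduct.tprod ℂ
        (Fin.cons (twist bar c.1.2 (y c.1.1)) (removeAt bar c y) : Fin (n + 1) → H) := by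
    intro c
    rw [act_tprod_twist]
    congr 1
    funext j
    have h : (absPerm (signedPerm (permCons c.1.1 1) (Fin.cons c.1.2 (lastSign c.1.2)))) j =
      permCons c.1.1 1 j := rfl
    rw [inv_inv, signedPerm_apply, h]
    refine Fin.cases ?_ (fun i => ?_) j
    · simp [permCons_zero]
    · simp [permCons_succ, removeAt]
  simp only [annih, LinearMap.comp_apply, LinearMap.sum_apply, LinearMap.smul_apply, map_sum,
    map_smul, key, contract_tprod, Fin.cons_zero, Fin.cons_succ, smul_smul]

/-- The factorization of the symmetrizer, with its first tensor factor paired with `x`. This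
intertwining is the reason why `annih` is adjoint to creation. -/
theorem contract_symmetrizer (q : ℝ) {bar : H →L[ℂ] H} (hbar : ∀ y, bar (bar y) = y) (x : H)
    {n : ℕ} (f : ⨂[ℂ]^(n + 1) H) :
    contract x n (symmetrizer q bar (n + 1) f) = symmetrizer q bar n (annih q bar x n f) := by
  induction f using PiTensorProduct.induction_on with
  | add f f' h h' => simp only [map_add, h, h']
  | smul_tprod r y =>
    rw [map_smul, map_smul, map_smul, map_smul, symmetrizer_succ_tprod q hbar, annih_tprod]
    simp only [map_sum, map_smul, contract_tensorCons, smul_smul]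

/-- The annihilation operator on the full Fock space. -/
def annihFock (q : ℝ) (bar : H →L[ℂ] H) (x : H) : Module.End ℂ (Fock H) :=
  DirectSum.toModule ℂ ℕ (Fock H) fun m =>
    match m with
    | 0 => 0
    | n + 1 => DirectSum.lof ℂ ℕ (fun n => ⨂[ℂ]^n H) n ∘ₗ annih q bar x n

theorem annihFock_lof_zero (q : ℝ) (bar : H →L[ℂ] H) (x : H) (f : ⨂[ℂ]^0 H) :
    annihFock q bar x (DirectSum.lof ℂ ℕ (fun n => ⨂[ℂ]^n H) 0 f) = 0 := by
  rw [annihFock, DirectSum.toModule_lof]; rfl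

theorem annihFock_lof_succ (q : ℝ) (bar : H →L[ℂ] H) (x : H) (n : ℕ) (f : ⨂[ℂ]^(n + 1) H) :
    annihFock q bar x (DirectSum.lof ℂ ℕ (fun n => ⨂[ℂ]^n H) (n + 1) f) =
      DirectSum.lof ℂ ℕ (fun n => ⨂[ℂ]^n H) n (annih q bar x n f) := by
  rw [annihFock, DirectSum.toModule_lof]; rfl

theorem annihFock_apply (q : ℝ) (bar : H →L[ℂ] H) (x : H) (f : Fock H) (n : ℕ) :
    annihFock q bar x f n = annih q bar x n (f (n + 1)) := by
  induction f using DirectSum.induction_on with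
  | zero => simp
  | add f f' h h' => simp only [map_add, DirectSum.add_apply, h, h']
  | of m a =>
    rw [← DirectSum.lof_eq_of ℂ]
    cases m with
    | zero =>
      rw [annihFock_lof_zero, DirectSum.lof_eq_of, DirectSum.of_eq_of_ne _ _ _ (by omega)]
      simp
    | succ m =>
      rw [annihFock_lof_succ]
      by_cases hmn : m = n
      · subst hmn
        rw [DirectSum.lof_apply, DirectSum.lof_apply]
      · rw [DirectSum.lof_eq_of, DirectSum.lof_eq_of, DirectSum.of_eq_of_ne _ _ _ (by omega),
          DirectSum.of_eq_of_ne _ _ _ (by omega), map_zero]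

theorem creation_lof (x : H) (n : ℕ) (f : ⨂[ℂ]^n H) :
    creation x (DirectSum.lof ℂ ℕ (fun n => ⨂[ℂ]^n H) n f) =
      DirectSum.lof ℂ ℕ (fun n => ⨂[ℂ]^n H) (n + 1) (tensorCons x n f) := by
  rw [creation, DirectSum.toModule_lof]; rfl

/-- Move the symmetrizer onto the left argument, where `contract_symmetrizer` trades `annih` for a
contraction; contraction is adjoint to `tensorCons` for the undeformed product. -/
theorem isAdjointQ_annihFock (q : ℝ) {bar : H →L[ℂ] H}
    (hsym : ∀ x y, inner ℂ (bar x) y = inner ℂ x (bar y)) (hbar : ∀ y, bar (bar y) = y) (x : H) :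
    IsAdjointQ q bar (annihFock q bar x) (creation x) := by
  intro f g
  induction g using DirectSum.induction_on with
  | zero => simp [innerQ_zero_right]
  | add g g' h h' => simp only [innerQ_add_right, map_add, h, h']
  | of n b =>
    rw [← DirectSum.lof_eq_of ℂ, creation_lof, innerQ_lof_right, innerQ_lof_right,
      annihFock_apply, ← tensorInner_symmetrizer q hsym, ← contract_symmetrizer q hbar,
      tensorInner_contract, tensorInner_symmetrizer q hsym]

theorem isAdjointQ_annihilation (q : ℝ) {bar : H →L[ℂ] H}
    (hsym : ∀ x y, inner ℂ (bar x) y = inner ℂ x (bar y)) (hbar : ∀ y, bar (bar y) = y) (x : H) :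
    IsAdjointQ q bar (annihilation q bar x) (creation x) :=
  Classical.epsilon_spec (p := fun T => IsAdjointQ q bar T (creation x))
    ⟨_, isAdjointQ_annihFock q hsym hbar x⟩

/-! ### Moments in terms of the explicit annihilation operators -/

/-- Sums of creation and annihilation operators, for a given choice of annihilation operators. -/
def opSum (T : H → Module.End ℂ (Fock H)) (E : Finset Bool) (x : H) : Module.End ℂ (Fock H) :=
  ∑ e ∈ E, if e = true then creation x else T x

theorem innerQ_sum_left {ι : Type*} (q : ℝ) (bar : H →L[ℂ] H) (s : Finset ι) (f : ι → Fock H)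
    (g : Fock H) : innerQ q bar (∑ i ∈ s, f i) g = ∑ i ∈ s, innerQ q bar (f i) g := by
  classical
  induction s using Finset.induction_on with
  | empty => simp [innerQ_zero_left]
  | insert a s ha ih => rw [Finset.sum_insert ha, Finset.sum_insert ha, innerQ_add_left, ih]

theorem innerQ_sum_right {ι : Type*} (q : ℝ) (bar : H →L[ℂ] H) (s : Finset ι) (f : Fock H)
    (g : ι → Fock H) : innerQ q bar f (∑ i ∈ s, g i) = ∑ i ∈ s, innerQ q bar f (g i) := by
  classical
  induction s using Finset.induction_on with
  | empty => simp [innerQ_zero_right]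
  | insert a s ha ih => rw [Finset.sum_insert ha, Finset.sum_insert ha, innerQ_add_right, ih]

/-- This replaces uniqueness of the adjoint. The leftmost operator is moved to the right argument,
which is arbitrary in the induction. -/
theorem innerQ_list_prod_congr (q : ℝ) {bar : H →L[ℂ] H}
    (hsym : ∀ x y, inner ℂ (bar x) y = inner ℂ x (bar y)) {T T' : H → Module.End ℂ (Fock H)}
    (hT : ∀ x, IsAdjointQ q bar (T x) (creation x))
    (hT' : ∀ x, IsAdjointQ q bar (T' x) (creation x)) {ι : Type*} (l : List ι)
    (E : ι → Finset Bool) (x : ι → H) (f g : Fock H) :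
    innerQ q bar ((l.map fun i => opSum T (E i) (x i)).prod f) g =
      innerQ q bar ((l.map fun i => opSum T' (E i) (x i)).prod f) g := by
  induction l generalizing g with
  | nil => rfl
  | cons i l ih =>
    have hc : ∀ (y : H) (f g : Fock H),
        innerQ q bar (creation y f) g = innerQ q bar f (T y g) := by
      intro y f g
      rw [← innerQ_conj q hsym, ← hT, innerQ_conj q hsym]
    simp only [List.map_cons, List.prod_cons, Module.End.mul_apply]
    rw [opSum, opSum, LinearMap.sum_apply, LinearMap.sum_apply, innerQ_sum_left, innerQ_sum_left]
    refine Finset.sum_congr rfl fun e _ => ?_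
    cases e
    · simp only [Bool.false_eq_true, if_false]
      rw [hT, hT', ih]
    · simp only [if_true]
      -- Both sides use the same adjoint `T` here, so the new right argument `T y g` is common to
      -- them.
      rw [hc, hc, ih]

theorem innerQ_prod_congr (q : ℝ) {bar : H →L[ℂ] H}
    (hsym : ∀ x y, inner ℂ (bar x) y = inner ℂ x (bar y)) {T T' : H → Module.End ℂ (Fock H)}
    (hT : ∀ x, IsAdjointQ q bar (T x) (creation x))
    (hT' : ∀ x, IsAdjointQ q bar (T' x) (creation x)) {n : ℕ} (E : Fin n → Finset Bool)
    (x : Fin n → H) (f g : Fock H) :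
    innerQ q bar g ((List.ofFn fun i => opSum T (E i) (x i)).prod f) =
      innerQ q bar g ((List.ofFn fun i => opSum T' (E i) (x i)).prod f) := by
  rw [← innerQ_conj q hsym, ← innerQ_conj q hsym _ g, List.ofFn_eq_map, List.ofFn_eq_map,
    innerQ_list_prod_congr q hsym hT hT']

/-- The tensor of the vectors `x_{e(0)}, x_{e(1)}, …`, the last one twisted by `b`. -/
def stateVec (bar : H →L[ℂ] H) {ι : Type*} (x : ι → H) {m : ℕ} (e : Fin m → ι) (b : ℤˣ) :
    Fock H :=
  DirectSum.lof ℂ ℕ (fun n => ⨂[ℂ]^n H) m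
    (PiTensorProduct.tprod ℂ fun j => twist bar (lastSign b j) (x (e j)))

/-- For `m = 0` the new vector is itself the last factor and would receive the twist `b`; `hb` rules
this out. -/
theorem creation_stateVec (bar : H →L[ℂ] H) {ι : Type*} (x : ι → H) {m : ℕ} (e : Fin m → ι)
    (b : ℤˣ) (hb : m = 0 → b = 1) (i : ι) :
    creation (x i) (stateVec bar x e b) =
      stateVec bar x (Fin.cons i e : Fin (m + 1) → ι) b := by
  rw [stateVec, creation_lof, tensorCons_tprod, stateVec]
  congr 2
  funext j
  refine Fin.cases ?_ (fun k => ?_) j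
  · by_cases h : m = 0
    · simp [lastSign, hb h, twist_one]
    · simp [lastSign, h, twist_one]
  · simp [lastSign]

theorem annihFock_stateVec_zero (q : ℝ) (bar : H →L[ℂ] H) {ι : Type*} (x : ι → H)
    (e : Fin 0 → ι) (b : ℤˣ) (y : H) : annihFock q bar y (stateVec bar x e b) = 0 := by
  rw [stateVec, annihFock_lof_zero]

theorem removeAt_state {bar : H →L[ℂ] H} (hbar : ∀ y, bar (bar y) = y) {ι : Type*} (x : ι → H)
    {m : ℕ} (e : Fin (m + 1) → ι) (b : ℤˣ) (c : Coset m) :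
    removeAt bar c (fun j => twist bar (lastSign b j) (x (e j))) = fun j =>
      twist bar (lastSign (c.1.2 * lastSign b c.1.1 * b) j) (x (e (c.1.1.succAbove j))) := by
  funext j
  rw [removeAt, twist_twist hbar]
  congr 2
  have hj := j.2
  have hk := c.1.1.2
  have := succAbove_val c.1.1 j
  unfold lastSign
  rw [this]
  split_ifs <;> first | omega | simp [mul_assoc]

/-- The sum over coset signs `t` becomes a sum over the colours `c = t * lastSign b k` seen by the
inner product. In every case the new bar is `c * b`, so the bar records the product of the colours
used. -/
theorem annihFock_stateVec (q : ℝ) {bar : H →L[ℂ] H} (hbar : ∀ y, bar (bar y) = y) {ι : Type*}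
    (x : ι → H) {m : ℕ} (e : Fin (m + 1) → ι) (b : ℤˣ) (y : H) :
    annihFock q bar y (stateVec bar x e b) = ∑ k : Fin (m + 1), ∑ c : ℤˣ,
      if m = 0 → c = b then
        ((q : ℂ) ^ ((k : ℕ) + if c = -1 then 2 * (m - k) else 0) *
          inner ℂ y (twist bar c (x (e k)))) • stateVec bar x (fun j => e (k.succAbove j)) (c * b)
      else 0 := by
  have h1 : ∀ F : Fin (m + 1) × ℤˣ → Fock H, ∑ c : Coset m, F c.1 =
      ∑ k : Fin (m + 1), ∑ t : ℤˣ, if m = 0 → t = 1 then F (k, t) else 0 := by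
    intro F
    rw [← Fintype.sum_prod_type' (f := fun k t => if m = 0 → t = 1 then F (k, t) else 0),
      ← Finset.sum_filter]
    exact (Finset.sum_subtype _ (by simp) _).symm
  rw [stateVec, annihFock_lof_succ, annih_tprod, map_sum]
  simp only [removeAt_state hbar, map_smul, twist_twist hbar]
  have h2 := h1 fun a => ((q : ℂ) ^ (if a.2 = 1 then (a.1 : ℕ) else 2 * m - a.1) *
    inner ℂ y (twist bar (a.2 * lastSign b a.1) (x (e a.1)))) •
      stateVec bar x (fun j => e (a.1.succAbove j)) (a.2 * lastSign b a.1 * b)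
  refine Eq.trans h2 (Finset.sum_congr rfl fun k _ => ?_)
  refine Eq.trans ?_ (Equiv.sum_comp (Equiv.mulRight (lastSign b k)) _)
  refine Finset.sum_congr rfl fun t _ => ?_
  have hk := k.2
  have hcond : (m = 0 → t * lastSign b k = b) ↔ (m = 0 → t = 1) := by
    refine forall_congr' fun h => ?_
    rw [lastSign, if_pos (by omega)]
    simp
  -- At the last place `k = m` both costs equal `m`, so it does not matter that `c` and `t` may
  -- differ there.
  have hexp : (if t = 1 then (k : ℕ) else 2 * m - k) =
      (k : ℕ) + if t * lastSign b k = -1 then 2 * (m - k) else 0 := by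
    by_cases hl : (k : ℕ) + 1 = m + 1
    · have : 2 * m - (k : ℕ) = k := by omega
      have h0 : m - (k : ℕ) = 0 := by omega
      simp [this, h0]
    · rw [lastSign, if_neg hl, mul_one]
      rcases Int.units_eq_one_or t with rfl | rfl
      · simp [show ¬ ((1 : ℤˣ) = -1) by decide]
      · simp [show ¬ ((-1 : ℤˣ) = 1) by decide]
        omega
  by_cases hp : m = 0 → t = 1
  · refine (if_pos hp).trans (Eq.trans ?_ (if_pos (hcond.2 hp)).symm)
    congr 3
  · exact (if_neg hp).trans (if_neg (mt hcond.1 hp)).symm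

theorem innerQ_vacuum_stateVec (q : ℝ) (bar : H →L[ℂ] H) {ι : Type*} (x : ι → H) {m : ℕ}
    (e : Fin m → ι) (b : ℤˣ) :
    innerQ q bar (vacuum H) (stateVec bar x e b) = if m = 0 then 1 else 0 := by
  rw [stateVec, innerQ_lof_right, vacuum]
  cases m with
  | zero =>
    have h : Unique (EvenSigned 0) :=
      { default := ⟨(1, fun i => i.elim0), by simp⟩
        uniq := fun a => by
          apply Subtype.ext
          exact Prod.ext (Equiv.ext fun i => i.elim0) (funext fun i => i.elim0) }
    rw [symmetrizer_tprod, DirectSum.lof_apply, Fintype.sum_unique, map_smul, tensorInner_tprod]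
    simp [EvenSigned.inv, invCount]
  | succ m =>
    rw [DirectSum.lof_eq_of, DirectSum.of_eq_of_ne _ _ _ (by omega)]
    simp

/-! ### Coloured matchings -/

/-- A coloured arc: its left end, its right end and its colour. -/
abbrev Arc (n : ℕ) : Type := Fin n × Fin n × ℤˣ

/-- The product of the colours of the arcs on the right of a point. -/
def rightSign {n : ℕ} (M : Finset (Arc n)) (i : Fin n) : ℤˣ :=
  ∏ a ∈ M with i < a.1, a.2.2

/-- The coloured perfect matchings of `{0, …, k - 1} ∪ S`, the points of `S` being right ends. The
colour of an arc whose left end lies below no other arc is forced, `b` being the product of the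
colours of the arcs that have been removed. The set `E i` tells whether `i` may be a left end
(`false`) or a right end (`true`). -/
structure IsMatching {n : ℕ} (E : Fin n → Finset Bool) (k : ℕ) (S : Finset (Fin n)) (b : ℤˣ)
    (M : Finset (Arc n)) : Prop where
  left_lt : ∀ a ∈ M, (a.1 : ℕ) < k
  lt : ∀ a ∈ M, a.1 < a.2.1
  right_mem : ∀ a ∈ M, (a.2.1 : ℕ) < k ∨ a.2.1 ∈ S
  left_allowed : ∀ a ∈ M, false ∈ E a.1
  right_allowed : ∀ a ∈ M, true ∈ E a.2.1
  exists_arc : ∀ i : Fin n, (i : ℕ) < k ∨ i ∈ S → ∃ a ∈ M, i = a.1 ∨ i = a.2.1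
  unique_arc : ∀ a ∈ M, ∀ a' ∈ M, ∀ i, (i = a.1 ∨ i = a.2.1) → (i = a'.1 ∨ i = a'.2.1) → a = a'
  color : ∀ a ∈ M, (∀ a' ∈ M, ¬ (a'.1 < a.1 ∧ a.1 < a'.2.1)) → a.2.2 = b * rightSign M a.1

/-- The exponent of `q` of an arc: its left crossings, and twice its covers if it is negative. -/
def arcExp {n : ℕ} (M : Finset (Arc n)) (a : Arc n) : ℕ :=
  Finset.card {a' ∈ M | a'.1 < a.1 ∧ a.1 < a'.2.1 ∧ a'.2.1 < a.2.1} +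
    if a.2.2 = -1 then 2 * Finset.card {a' ∈ M | a'.1 < a.1 ∧ a.2.1 < a'.2.1} else 0

/-- The weight of a coloured matching. -/
def matchWeight (q : ℝ) (bar : H →L[ℂ] H) {n : ℕ} (x : Fin n → H) (M : Finset (Arc n)) : ℂ :=
  ∏ a ∈ M, ((q : ℂ) ^ arcExp M a * inner ℂ (x a.1) (twist bar a.2.2 (x a.2.1)))

variable {n : ℕ} {E : Fin n → Finset Bool}

theorem isMatching_zero_iff {S : Finset (Fin n)} {b : ℤˣ} {M : Finset (Arc n)} :
    IsMatching E 0 S b M ↔ M = ∅ ∧ S = ∅ := by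
  constructor
  · intro h
    have hM : M = ∅ :=
      Finset.eq_empty_of_forall_notMem fun a ha => Nat.not_lt_zero _ (h.left_lt a ha)
    refine ⟨hM, Finset.eq_empty_of_forall_notMem fun i hi => ?_⟩
    obtain ⟨a, ha, -⟩ := h.exists_arc i (Or.inr hi)
    simp [hM] at ha
  · rintro ⟨rfl, rfl⟩
    constructor <;> simp

/-- If `k` is not a left end it is a right end, so it may be moved to the set of open right ends.
This is the effect of a creation operator. -/
theorem isMatching_insert_iff {k : Fin n} {S : Finset (Fin n)} {b : ℤˣ} {M : Finset (Arc n)}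
    (hk : true ∈ E k) :
    IsMatching E k (insert k S) b M ↔
      IsMatching E (k + 1) S b M ∧ ¬ ∃ a ∈ M, a.1 = k := by
  have hiff : ∀ i : Fin n, ((i : ℕ) < k ∨ i ∈ insert k S) ↔ ((i : ℕ) < k + 1 ∨ i ∈ S) := by
    intro i
    rw [Finset.mem_insert, Nat.lt_succ_iff_lt_or_eq, ← Fin.ext_iff, or_assoc]
  constructor
  · intro h
    refine ⟨⟨fun a ha => (h.left_lt a ha).trans (Nat.lt_succ_self _), h.lt,
      fun a ha => (hiff _).1 (h.right_mem a ha), h.left_allowed, h.right_allowed,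
      fun i hi => h.exists_arc i ((hiff _).2 hi), h.unique_arc, h.color⟩, ?_⟩
    rintro ⟨a, ha, rfl⟩
    exact lt_irrefl _ (h.left_lt a ha)
  · rintro ⟨h, h'⟩
    refine ⟨fun a ha => ?_, h.lt, fun a ha => (hiff _).2 (h.right_mem a ha), h.left_allowed,
      h.right_allowed, fun i hi => h.exists_arc i ((hiff _).1 hi), h.unique_arc, h.color⟩
    refine lt_of_le_of_ne (Nat.lt_succ_iff.1 (h.left_lt a ha)) fun e => h' ⟨a, ha, Fin.ext e⟩

theorem IsMatching.right_mem_of_lt {k : ℕ} {S : Finset (Fin n)} {b : ℤˣ} {M : Finset (Arc n)}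
    (h : IsMatching E k S b M) {a : Arc n} (ha : a ∈ M) (hlt : k ≤ (a.2.1 : ℕ)) : a.2.1 ∈ S :=
  (h.right_mem a ha).resolve_left (by omega)

theorem IsMatching.exists_right {k : ℕ} {S : Finset (Fin n)} {b : ℤˣ} {M : Finset (Arc n)}
    (h : IsMatching E k S b M) {i : Fin n} (hi : i ∈ S) (hk : k ≤ (i : ℕ)) :
    ∃ a ∈ M, a.2.1 = i := by
  obtain ⟨a, ha, rfl | rfl⟩ := h.exists_arc i (Or.inr hi)
  · exact absurd (h.left_lt a ha) (by omega)
  · exact ⟨a, ha, rfl⟩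

theorem rightSign_insert {M : Finset (Arc n)} {a : Arc n} (ha : a ∉ M) {i : Fin n}
    (hi : i < a.1) : rightSign (insert a M) i = a.2.2 * rightSign M i := by
  rw [rightSign, Finset.filter_insert, if_pos hi, Finset.prod_insert (by simp [ha]), rightSign]

theorem rightSign_eq_one {M : Finset (Arc n)} {i : Fin n} (h : ∀ a ∈ M, a.1 ≤ i) :
    rightSign M i = 1 := by
  rw [rightSign, Finset.filter_false_of_mem fun a ha => (h a ha).not_gt, Finset.prod_empty]

/-- All arcs of `M` start before `k`, so the new arc lies on their right and multiplies their right
signs by `c`; this is absorbed by passing from `c * b` to `b`. -/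
theorem IsMatching.insert_arc {k j : Fin n} {S : Finset (Fin n)} {b c : ℤˣ} {M : Finset (Arc n)}
    (h : IsMatching E k (S.erase j) (c * b) M) (hj : j ∈ S) (hS : ∀ i ∈ S, k < i)
    (hEk : false ∈ E k) (hEj : true ∈ E j) (hc : S.card = 1 → c = b) :
    IsMatching E (k + 1) S b (insert (k, j, c) M) := by
  have hleft : ∀ a ∈ M, a.1 < k := fun a ha => h.left_lt a ha
  have hk : ∀ a ∈ M, ¬ (k = a.1 ∨ k = a.2.1) := by
    rintro a ha (e | e)
    · exact (hleft a ha).ne e.symm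
    · rcases h.right_mem a ha with h1 | h1
      · rw [← e] at h1; exact lt_irrefl _ h1
      · rw [← e] at h1; exact lt_irrefl _ (hS k (Finset.mem_of_mem_erase h1))
  have hj' : ∀ a ∈ M, ¬ (j = a.1 ∨ j = a.2.1) := by
    rintro a ha (e | e)
    · exact lt_asymm (hleft a ha) (e ▸ hS j hj)
    · rcases h.right_mem a ha with h1 | h1
      · rw [← e] at h1; exact lt_asymm (hS j hj) h1
      · rw [← e] at h1; simp at h1
  have hnot : (k, j, c) ∉ M := fun hm => hk _ hm (Or.inl rfl)
  constructor
  · simp only [Finset.mem_insert, forall_eq_or_imp]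
    exact ⟨Nat.lt_succ_self _, fun a ha => Nat.lt_succ_of_lt (hleft a ha)⟩
  · simp only [Finset.mem_insert, forall_eq_or_imp]
    exact ⟨hS j hj, h.lt⟩
  · simp only [Finset.mem_insert, forall_eq_or_imp]
    refine ⟨Or.inr hj, fun a ha => ?_⟩
    exact (h.right_mem a ha).imp Nat.lt_succ_of_lt Finset.mem_of_mem_erase
  · simp only [Finset.mem_insert, forall_eq_or_imp]
    exact ⟨hEk, h.left_allowed⟩
  · simp only [Finset.mem_insert, forall_eq_or_imp]
    exact ⟨hEj, h.right_allowed⟩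
  · intro i hi
    by_cases h1 : i = k
    · exact ⟨_, Finset.mem_insert_self _ _, Or.inl h1⟩
    by_cases h2 : i = j
    · exact ⟨_, Finset.mem_insert_self _ _, Or.inr h2⟩
    obtain ⟨a, ha, e⟩ := h.exists_arc i (by
      rcases hi with hi | hi
      · exact Or.inl (lt_of_le_of_ne (Nat.lt_succ_iff.1 hi) fun e => h1 (Fin.ext e))
      · exact Or.inr (Finset.mem_erase.2 ⟨h2, hi⟩))
    exact ⟨a, Finset.mem_insert_of_mem ha, e⟩
  · intro a ha a' ha' i hi hi'
    rcases Finset.mem_insert.1 ha with rfl | hm <;>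
      rcases Finset.mem_insert.1 ha' with rfl | hm'
    · rfl
    · rcases hi with rfl | rfl
      · exact absurd hi' (hk a' hm')
      · exact absurd hi' (hj' a' hm')
    · rcases hi' with rfl | rfl
      · exact absurd hi (hk a hm)
      · exact absurd hi (hj' a hm)
    · exact h.unique_arc a hm a' hm' i hi hi'
  · simp only [Finset.mem_insert, forall_eq_or_imp]
    refine ⟨fun hfree => ?_, fun a ha hfree => ?_⟩
    -- Any open right end other than `j` would belong to an arc passing over `k`. Hence an uncovered
    -- and uncrossed left end `k` means that `S = {j}`.
    · rw [rightSign_eq_one, mul_one]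
      · apply hc
        rw [Finset.card_eq_one]
        refine ⟨j, Finset.eq_singleton_iff_unique_mem.2 ⟨hj, fun i hi => ?_⟩⟩
        by_contra hij
        obtain ⟨a, ha, rfl⟩ := h.exists_right (Finset.mem_erase.2 ⟨hij, hi⟩) (hS i hi).le
        exact hfree.2 a ha ⟨hleft a ha, hS _ hi⟩
      · simp only [Finset.mem_insert, forall_eq_or_imp]
        exact ⟨le_rfl, fun a ha => (hleft a ha).le⟩
    · rw [rightSign_insert hnot (hleft a ha), h.color a ha hfree.2, mul_comm c b, mul_assoc]

theorem IsMatching.erase_arc {k j : Fin n} {S : Finset (Fin n)} {b c : ℤˣ} {M : Finset (Arc n)}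
    (h : IsMatching E (k + 1) S b M) (hM : (k, j, c) ∈ M) (hS : ∀ i ∈ S, k < i) :
    j ∈ S ∧ (S.card = 1 → c = b) ∧
      IsMatching E k (S.erase j) (c * b) (M.erase (k, j, c)) := by
  have hkj : k < j := h.lt _ hM
  have hj : j ∈ S := h.right_mem_of_lt hM hkj
  have hleft : ∀ a ∈ M.erase (k, j, c), a.1 < k := by
    intro a ha
    obtain ⟨hne, ha⟩ := Finset.mem_erase.1 ha
    refine lt_of_le_of_ne (Nat.lt_succ_iff.1 (h.left_lt a ha)) fun e => hne ?_
    exact h.unique_arc a ha _ hM k (Or.inl e.symm) (Or.inl rfl)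
  have hleft' : ∀ a ∈ M, a.1 ≤ k := fun a ha => Nat.lt_succ_iff.1 (h.left_lt a ha)
  have hins : insert (k, j, c) (M.erase (k, j, c)) = M := Finset.insert_erase hM
  refine ⟨hj, fun hcard => ?_, ?_⟩
  · have := h.color _ hM ?_
    · rwa [rightSign_eq_one hleft', mul_one] at this
    · rintro a ha ⟨h1, h2⟩
      have h3 : a.2.1 ∈ S := h.right_mem_of_lt ha h2
      obtain ⟨i, rfl⟩ := Finset.card_eq_one.1 hcard
      rw [Finset.mem_singleton] at h3 hj
      have := h.unique_arc a ha _ hM j (Or.inr (hj.trans h3.symm)) (Or.inr rfl)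
      rw [this] at h1
      exact lt_irrefl _ h1
  · constructor
    · exact hleft
    · exact fun a ha => h.lt a (Finset.mem_of_mem_erase ha)
    · intro a ha
      obtain ⟨hne, ha'⟩ := Finset.mem_erase.1 ha
      rcases h.right_mem a ha' with h1 | h1
      · refine Or.inl (lt_of_le_of_ne (Nat.lt_succ_iff.1 h1) fun e => hne ?_)
        exact h.unique_arc a ha' _ hM k (Or.inr (Fin.ext e.symm)) (Or.inl rfl)
      · refine Or.inr (Finset.mem_erase.2 ⟨fun e => hne ?_, h1⟩)
        exact h.unique_arc a ha' _ hM j (Or.inr e.symm) (Or.inr rfl)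
    · exact fun a ha => h.left_allowed a (Finset.mem_of_mem_erase ha)
    · exact fun a ha => h.right_allowed a (Finset.mem_of_mem_erase ha)
    · intro i hi
      obtain ⟨a, ha, e⟩ := h.exists_arc i
        (hi.imp Nat.lt_succ_of_lt Finset.mem_of_mem_erase)
      refine ⟨a, Finset.mem_erase.2 ⟨?_, ha⟩, e⟩
      rintro rfl
      rcases e with rfl | rfl
      · rcases hi with hi | hi
        · exact lt_irrefl _ hi
        · exact lt_irrefl _ (hS _ (Finset.mem_of_mem_erase hi))
      · rcases hi with hi | hi
        · exact lt_asymm hkj hi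
        · simp at hi
    · exact fun a ha a' ha' =>
        h.unique_arc a (Finset.mem_of_mem_erase ha) a' (Finset.mem_of_mem_erase ha')
    · intro a ha hfree
      have h1 := h.color a (Finset.mem_of_mem_erase ha) ?_
      · rw [h1]
        conv_lhs => rw [← hins, rightSign_insert (Finset.notMem_erase _ _) (hleft a ha)]
        rw [mul_comm c b, mul_assoc]
      · intro a' ha' hlt
        by_cases e : a' = (k, j, c)
        · rw [e] at hlt
          exact lt_asymm hlt.1 (hleft a ha)
        · exact hfree a' (Finset.mem_erase.2 ⟨e, ha'⟩) hlt

/-- Points of `S` correspond bijectively to the arcs of `M` passing over `k`; this converts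
crossings and covers into counts of open right ends. -/
theorem IsMatching.card_filter {k : Fin n} {S : Finset (Fin n)} {b : ℤˣ} {M : Finset (Arc n)}
    (h : IsMatching E k S b M) (hS : ∀ i ∈ S, k < i) (P : Fin n → Prop) [DecidablePred P]
    (P' : Arc n → Prop) [DecidablePred P'] (hP : ∀ a ∈ M, P' a ↔ k < a.2.1 ∧ P a.2.1) :
    Finset.card {a ∈ M | P' a} = Finset.card {i ∈ S | P i} := by
  have : ({i ∈ S | P i} : Finset (Fin n)) =
      ({a ∈ M | P' a} : Finset (Arc n)).image fun a => a.2.1 := by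
    ext i
    simp only [Finset.mem_filter, Finset.mem_image]
    constructor
    · rintro ⟨hi, hp⟩
      obtain ⟨a, ha, rfl⟩ := h.exists_right hi (hS i hi).le
      exact ⟨a, ⟨ha, (hP a ha).2 ⟨hS _ hi, hp⟩⟩, rfl⟩
    · rintro ⟨a, ⟨ha, hp⟩, rfl⟩
      obtain ⟨h1, h2⟩ := (hP a ha).1 hp
      exact ⟨h.right_mem_of_lt ha h1.le, h2⟩
  rw [this, Finset.card_image_of_injOn]
  intro a ha a' ha' e
  simp only [Finset.coe_filter, Set.mem_ofPred_eq] at ha ha' e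
  exact h.unique_arc a ha.1 a' ha'.1 a.2.1 (Or.inr rfl) (Or.inr e)

/-- The remaining right ends before `j` give left crossings of the new arc, those after `j` give
covers. The new arc starts to the right of all the others, so their exponents do not change. -/
theorem IsMatching.matchWeight_insert (q : ℝ) (bar : H →L[ℂ] H) (x : Fin n → H) {k j : Fin n}
    {S : Finset (Fin n)} {b c : ℤˣ} {M : Finset (Arc n)}
    (h : IsMatching E k (S.erase j) b M) (hj : j ∈ S) (hS : ∀ i ∈ S, k < i) :
    matchWeight q bar x (insert (k, j, c) M) =
      ((q : ℂ) ^ (Finset.card {i ∈ S | i < j} +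
          if c = -1 then 2 * Finset.card {i ∈ S | j < i} else 0) *
        inner ℂ (x k) (twist bar c (x j))) * matchWeight q bar x M := by
  have hleft : ∀ a ∈ M, a.1 < k := fun a ha => h.left_lt a ha
  have hnot : (k, j, c) ∉ M := fun hm => lt_irrefl _ (hleft _ hm)
  have hS' : ∀ i ∈ S.erase j, k < i := fun i hi => hS i (Finset.mem_of_mem_erase hi)
  rw [matchWeight, Finset.prod_insert hnot]
  congr 1
  · congr 2
    have e1 := h.card_filter hS' (fun i => i < j)
      (fun a => a.1 < k ∧ k < a.2.1 ∧ a.2.1 < j) fun a ha => and_iff_right (hleft a ha)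
    have e2 := h.card_filter hS' (fun i => j < i) (fun a => a.1 < k ∧ j < a.2.1) fun a ha =>
      ⟨fun h2 => ⟨(hS j hj).trans h2.2, h2.2⟩, fun h2 => ⟨hleft a ha, h2.2⟩⟩
    have e3 : ({i ∈ S.erase j | i < j} : Finset (Fin n)) = {i ∈ S | i < j} := by
      ext i
      simp only [Finset.mem_filter, Finset.mem_erase]
      exact ⟨fun h => ⟨h.1.2, h.2⟩, fun h => ⟨⟨h.2.ne, h.1⟩, h.2⟩⟩
    have e4 : ({i ∈ S.erase j | j < i} : Finset (Fin n)) = {i ∈ S | j < i} := by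
      ext i
      simp only [Finset.mem_filter, Finset.mem_erase]
      exact ⟨fun h => ⟨h.1.2, h.2⟩, fun h => ⟨⟨h.2.ne', h.1⟩, h.2⟩⟩
    rw [e3] at e1
    rw [e4] at e2
    simp only [arcExp, Finset.filter_insert, lt_irrefl, false_and, if_false]
    rw [e1, e2]
  · refine Finset.prod_congr rfl fun a ha => ?_
    have h1 : ¬ (k < a.1) := (hleft a ha).not_gt
    congr 2
    simp only [arcExp, Finset.filter_insert, h1, false_and, if_false]

/-! ### Moments as sums over coloured matchings -/

open scoped Classical in
/-- The finite set of the coloured matchings `IsMatching E k S b`. -/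
def matchings {n : ℕ} (E : Fin n → Finset Bool) (k : ℕ) (S : Finset (Fin n)) (b : ℤˣ) :
    Finset (Finset (Arc n)) := {M | IsMatching E k S b M}

theorem mem_matchings {k : ℕ} {S : Finset (Fin n)} {b : ℤˣ} {M : Finset (Arc n)} :
    M ∈ matchings E k S b ↔ IsMatching E k S b M := by simp [matchings]

open scoped Classical in
-- The combinatorial counterpart of `annihFock_stateVec`: removing the arc that starts at `k` is a
-- bijection onto triples of a right end, a colour and a smaller matching.
theorem sum_matchings_left (q : ℝ) (bar : H →L[ℂ] H) (x : Fin n → H) {k : Fin n}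
    {S : Finset (Fin n)} {b : ℤˣ} (hS : ∀ i ∈ S, k < i) (hSE : ∀ i ∈ S, true ∈ E i)
    (hEk : false ∈ E k) :
    ∑ M ∈ matchings E (k + 1) S b with ∃ a ∈ M, a.1 = k, matchWeight q bar x M =
      ∑ j ∈ S, ∑ c : ℤˣ, if S.card = 1 → c = b then
        ((q : ℂ) ^ (Finset.card {i ∈ S | i < j} +
          if c = -1 then 2 * Finset.card {i ∈ S | j < i} else 0) *
        inner ℂ (x k) (twist bar c (x j))) *
          ∑ M ∈ matchings E k (S.erase j) (c * b), matchWeight q bar x M else 0 := by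
  rw [← Finset.sum_product' (f := fun j c => if S.card = 1 → c = b then
    ((q : ℂ) ^ (Finset.card {i ∈ S | i < j} +
      if c = -1 then 2 * Finset.card {i ∈ S | j < i} else 0) *
        inner ℂ (x k) (twist bar c (x j))) *
          ∑ M ∈ matchings E k (S.erase j) (c * b), matchWeight q bar x M else 0),
    ← Finset.sum_filter]
  simp only [Finset.mul_sum]
  rw [Finset.sum_sigma']
  symm
  refine Finset.sum_bij (fun z _ => insert (k, z.1.1, z.1.2) z.2) ?_ ?_ ?_ ?_
  · rintro ⟨⟨j, c⟩, M⟩ hz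
    simp only [Finset.mem_sigma, Finset.mem_filter, Finset.mem_product, Finset.mem_univ, and_true,
      mem_matchings] at hz ⊢
    exact ⟨hz.2.insert_arc hz.1.1 hS hEk (hSE _ hz.1.1) hz.1.2, _, Finset.mem_insert_self _ _, rfl⟩
  · rintro ⟨⟨j, c⟩, M⟩ hz ⟨⟨j', c'⟩, M'⟩ hz' h
    simp only [Finset.mem_sigma, Finset.mem_filter, Finset.mem_product, Finset.mem_univ, and_true,
      mem_matchings] at hz hz' h
    have hnot : ∀ {j : Fin n} {c : ℤˣ}, (k, j, c) ∉ M :=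
      fun hm => lt_irrefl _ (hz.2.left_lt _ hm)
    have hnot' : ∀ {j : Fin n} {c : ℤˣ}, (k, j, c) ∉ M' :=
      fun hm => lt_irrefl _ (hz'.2.left_lt _ hm)
    have h1 : (k, j, c) ∈ insert (k, j', c') M' := h ▸ Finset.mem_insert_self _ _
    have h2 := (Finset.mem_insert.1 h1).resolve_right hnot'
    simp only [Prod.mk.injEq, true_and] at h2
    obtain ⟨rfl, rfl⟩ := h2
    rw [← Finset.erase_insert (hnot (j := j) (c := c)), h, Finset.erase_insert hnot']
  · intro M hM
    simp only [Finset.mem_filter, mem_matchings] at hM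
    obtain ⟨hM, ⟨k', j, c⟩, ha, rfl⟩ := hM
    obtain ⟨h1, h2, h3⟩ := hM.erase_arc ha hS
    refine ⟨⟨(j, c), M.erase (k', j, c)⟩, ?_, Finset.insert_erase ha⟩
    simp only [Finset.mem_sigma, Finset.mem_filter, Finset.mem_product, Finset.mem_univ, and_true,
      mem_matchings]
    exact ⟨⟨h1, h2⟩, h3⟩
  · rintro ⟨⟨j, c⟩, M⟩ hz
    simp only [Finset.mem_sigma, Finset.mem_filter, Finset.mem_product, Finset.mem_univ, and_true,
      mem_matchings] at hz
    exact (hz.2.matchWeight_insert q bar x hz.1.1 hS).symm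

open scoped Classical in
theorem matchings_right {k : Fin n} {S : Finset (Fin n)} {b : ℤˣ} (hk : true ∈ E k) :
    {M ∈ matchings E (k + 1) S b | ¬ ∃ a ∈ M, a.1 = k} = matchings E k (insert k S) b := by
  ext M
  rw [Finset.mem_filter, mem_matchings, mem_matchings, isMatching_insert_iff hk]

open scoped Classical in
theorem matchings_right_eq_empty {k : Fin n} {S : Finset (Fin n)} {b : ℤˣ} (hk : true ∉ E k) :
    {M ∈ matchings E (k + 1) S b | ¬ ∃ a ∈ M, a.1 = k} = ∅ := by
  refine Finset.filter_eq_empty_iff.2 fun M hM h => ?_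
  rw [mem_matchings] at hM
  obtain ⟨a, ha, e | e⟩ := hM.exists_arc k (Or.inl (Nat.lt_succ_self _))
  · exact h ⟨a, ha, e.symm⟩
  · exact hk (e ▸ hM.right_allowed a ha)

open scoped Classical in
theorem matchings_left_eq_empty {k : Fin n} {S : Finset (Fin n)} {b : ℤˣ} (hk : false ∉ E k) :
    {M ∈ matchings E (k + 1) S b | ∃ a ∈ M, a.1 = k} = ∅ := by
  refine Finset.filter_eq_empty_iff.2 ?_
  rintro M hM ⟨a, ha, rfl⟩
  exact hk ((mem_matchings.1 hM).left_allowed a ha)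

theorem opSum_eq (T : H → Module.End ℂ (Fock H)) (F : Finset Bool) (y : H) :
    opSum T F y = (if true ∈ F then creation y else 0) + if false ∈ F then T y else 0 := by
  have h := Finset.sum_ite_mem Finset.univ F fun e => if e = true then creation y else T y
  rw [Finset.univ_inter, Fintype.sum_bool] at h
  simpa [opSum] using h.symm

/-- Operator side and matching side obey the same recursion. The operators at the points from `k` on
have been applied, the image of `e` is the set of open right ends, and `b` is the pending bar. -/
theorem innerQ_take_prod_stateVec (q : ℝ) {bar : H →L[ℂ] H} (hbar : ∀ y, bar (bar y) = y)
    (x : Fin n → H) (k : ℕ) (hk : k ≤ n) {m : ℕ} (e : Fin m → Fin n) (he : StrictMono e)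
    (hke : ∀ j, k ≤ (e j : ℕ)) (hE : ∀ j, true ∈ E (e j)) (b : ℤˣ) (hb : m = 0 → b = 1) :
    innerQ q bar (vacuum H)
        (((List.ofFn fun i => opSum (annihFock q bar) (E i) (x i)).take k).prod
          (stateVec bar x e b)) =
      ∑ M ∈ matchings E k (Finset.univ.image e) b, matchWeight q bar x M := by
  classical
  induction k generalizing m b with
  | zero =>
    have h0 : matchings E 0 (Finset.univ.image e) b = if m = 0 then {∅} else ∅ := by
      ext M
      rw [mem_matchings, isMatching_zero_iff, Finset.image_eq_empty, Finset.univ_eq_empty_iff]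
      cases m <;> simp [Fin.isEmpty]
    rw [List.take_zero, List.prod_nil, Module.End.one_apply, innerQ_vacuum_stateVec, h0]
    split_ifs <;> simp [matchWeight]
  | succ k ih =>
    have hkn : k < n := hk
    obtain ⟨i, rfl⟩ : ∃ i : Fin n, k = i := ⟨⟨k, hkn⟩, rfl⟩
    have hlen : (i : ℕ) < (List.ofFn fun i => opSum (annihFock q bar) (E i) (x i)).length := by
      simp
    have hS : ∀ j ∈ Finset.univ.image e, i < j := by
      intro j hj
      obtain ⟨a, -, rfl⟩ := Finset.mem_image.1 hj
      exact hke a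
    -- The last operator of the truncated list acts first. Its annihilation part corresponds to the
    -- matchings in which `i` is a left end, its creation part to the others.
    rw [List.prod_take_succ _ _ hlen, List.getElem_ofFn, Module.End.mul_apply, opSum_eq,
      LinearMap.add_apply, map_add, innerQ_add_right,
      ← Finset.sum_filter_add_sum_filter_not _ (fun M => ∃ a ∈ M, a.1 = i), add_comm]
    congr 1
    · by_cases hf : false ∈ E i
      · rw [if_pos hf, sum_matchings_left q bar x hS (by simpa using hE) hf]
        cases m with
        | zero => simp [annihFock_stateVec_zero, innerQ_zero_right]
        | succ m =>
          rw [annihFock_stateVec q hbar, map_sum, innerQ_sum_right,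
            Finset.sum_image fun a _ a' _ h => he.injective h]
          refine Finset.sum_congr rfl fun j _ => ?_
          rw [map_sum, innerQ_sum_right]
          refine Finset.sum_congr rfl fun c _ => ?_
          have hcard : (Finset.univ.image e).card = 1 ↔ m = 0 := by
            rw [Finset.card_image_of_injective _ he.injective]; simp
          simp only [hcard]
          by_cases hc : m = 0 → c = b
          · rw [if_pos hc, if_pos hc, map_smul, innerQ_smul_right]
            have hmono : StrictMono fun l => e (j.succAbove l) :=
              he.comp (Fin.strictMono_succAbove j)
            rw [ih hkn.le _ hmono (fun l => (Nat.le_succ _).trans (hke _)) (fun l => hE _) _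
              (fun h => by rw [hc h, Int.units_mul_self])]
            have himg : Finset.univ.image (fun l => e (j.succAbove l)) =
                (Finset.univ.image e).erase (e j) := by
              ext a
              simp only [Finset.mem_image, Finset.mem_erase, Finset.mem_univ, true_and]
              constructor
              · rintro ⟨l, rfl⟩
                exact ⟨fun h => Fin.succAbove_ne _ _ (he.injective h), _, rfl⟩
              · rintro ⟨hne, l, rfl⟩
                obtain ⟨l', rfl⟩ := Fin.exists_succAbove_eq (x := l) (y := j)
                  (fun h => hne (h ▸ rfl))
                exact ⟨l', rfl⟩
            -- As `e` is increasing, the index of a tensor factor counts the open right ends before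
            -- it.
            have h1 : Finset.card {a ∈ Finset.univ.image e | a < e j} = j := by
              rw [Finset.filter_image, Finset.card_image_of_injective _ he.injective]
              simp only [he.lt_iff_lt]
              rw [Finset.filter_gt_eq_Iio, Fin.card_Iio]
            have h2 : Finset.card {a ∈ Finset.univ.image e | e j < a} = m - j := by
              rw [Finset.filter_image, Finset.card_image_of_injective _ he.injective]
              simp only [he.lt_iff_lt]
              rw [Finset.filter_lt_eq_Ioi, Fin.card_Ioi]
              omega
            rw [himg, h1, h2]
          · rw [if_neg hc, if_neg hc, map_zero, innerQ_zero_right]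
      · rw [if_neg hf, matchings_left_eq_empty hf]
        simp [innerQ_zero_right]
    · by_cases ht : true ∈ E i
      · rw [if_pos ht, matchings_right ht, creation_stateVec _ _ _ _ hb,
          ih hkn.le (Fin.cons i e) _ _ _ b (by simp)]
        · congr 2
          ext a
          simp only [Finset.mem_image, Finset.mem_univ, true_and, Finset.mem_insert]
          rw [Fin.exists_fin_succ]
          simp [eq_comm]
        · intro a a' h
          induction a' using Fin.cases with
          | zero => exact absurd h (Fin.not_lt_zero a)
          | succ a' =>
            induction a using Fin.cases with
            | zero => simpa using hke a'
            | succ a => simpa using he (Fin.succ_lt_succ_iff.1 h)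
        · intro j; refine Fin.cases ?_ (fun l => ?_) j
          · simp
          · simpa using (Nat.le_succ _).trans (hke l)
        · intro j; refine Fin.cases ?_ (fun l => ?_) j
          · simpa using ht
          · simpa using hE l
      · rw [if_neg ht, matchings_right_eq_empty ht]
        simp [innerQ_zero_right]

theorem moment_eq_sum_matchings (q : ℝ) {bar : H →L[ℂ] H} (hbar : ∀ y, bar (bar y) = y)
    (hsym : ∀ x y, inner ℂ (bar x) y = inner ℂ x (bar y)) (E : Fin n → Finset Bool)
    (x : Fin n → H) :
    innerQ q bar (vacuum H)
        ((List.ofFn fun i => opSum (annihilation q bar) (E i) (x i)).prod (vacuum H)) =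
      ∑ M ∈ matchings E n ∅ 1, matchWeight q bar x M := by
  rw [innerQ_prod_congr q hsym (isAdjointQ_annihilation q hsym hbar)
    (isAdjointQ_annihFock q hsym hbar)]
  have h := innerQ_take_prod_stateVec (E := E) q hbar x n le_rfl (m := 0) (fun i => i.elim0)
    (fun i => i.elim0) (fun i => i.elim0) (fun i => i.elim0) 1 (fun _ => rfl)
  rw [List.take_of_length_le (by simp), Finset.univ_eq_empty, Finset.image_empty] at h
  rw [← h]
  congr 2
  rw [vacuum, stateVec]
  congr 2
  funext i
  exact i.elim0

/-! ### Coloured matchings and coloured pair partitions -/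

/-- The coloured arc of a block. -/
def arcOf (p : ColoredPartition n) (V : {V : Finset (Fin n) // V ∈ p.1.parts}) : Arc n :=
  (left V, right V, p.2 V)

/-- The coloured arcs of a coloured partition. -/
def arcs (p : ColoredPartition n) : Finset (Arc n) := Finset.univ.image (arcOf p)

theorem mem_arcs {p : ColoredPartition n} {a : Arc n} : a ∈ arcs p ↔ ∃ V, arcOf p V = a := by
  simp [arcs]

/-- All the blocks are pairs. -/
def IsPairing (p : ColoredPartition n) : Prop := ∀ V ∈ p.1.parts, V.card = 2

/-! ### Blocks and their relative positions in terms of end points. -/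

section Blocks

variable {π : SetPartition n}

theorem left_mem (V : {V : Finset (Fin n) // V ∈ π.parts}) : left V ∈ V.1 := Finset.min'_mem _ _

theorem right_mem (V : {V : Finset (Fin n) // V ∈ π.parts}) : right V ∈ V.1 :=
  Finset.max'_mem _ _

theorem left_le (V : {V : Finset (Fin n) // V ∈ π.parts}) {i : Fin n} (hi : i ∈ V.1) :
    left V ≤ i := Finset.min'_le _ _ hi

theorem le_right (V : {V : Finset (Fin n) // V ∈ π.parts}) {i : Fin n} (hi : i ∈ V.1) :
    i ≤ right V := Finset.le_max' _ _ hi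

theorem left_lt_right {V : {V : Finset (Fin n) // V ∈ π.parts}} (hV : V.1.card = 2) :
    left V < right V := Finset.min'_lt_max'_of_card _ (by omega)

theorem mem_block_iff {V : {V : Finset (Fin n) // V ∈ π.parts}} (hV : V.1.card = 2) (i : Fin n) :
    i ∈ V.1 ↔ i = left V ∨ i = right V := by
  have h : ({left V, right V} : Finset (Fin n)) = V.1 := by
    refine Finset.eq_of_subset_of_card_le ?_ ?_
    · intro i hi
      rcases Finset.mem_insert.1 hi with rfl | hi
      · exact left_mem V
      · rw [Finset.mem_singleton.1 hi]; exact right_mem V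
    · rw [hV, Finset.card_pair (left_lt_right hV).ne]
  rw [← h]; simp

theorem block_unique {V W : {V : Finset (Fin n) // V ∈ π.parts}} {i : Fin n} (hV : i ∈ V.1)
    (hW : i ∈ W.1) : V = W :=
  Subtype.ext (π.eq_of_mem_parts V.2 W.2 hV hW)

theorem rightOf_iff (V W : {V : Finset (Fin n) // V ∈ π.parts}) :
    RightOf W.1 V.1 ↔ left V < left W := by
  rw [RightOf, ← Finset.coe_min' (π.nonempty_of_mem_parts V.2),
    ← Finset.coe_min' (π.nonempty_of_mem_parts W.2), WithTop.coe_lt_coe]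
  rfl

theorem covers_iff (V W : {V : Finset (Fin n) // V ∈ π.parts}) :
    Covers W.1 V.1 ↔ left W < left V ∧ right V < right W := by
  constructor
  · rintro ⟨i, hi, j, hj, h⟩
    exact ⟨(left_le W hi).trans_lt (h _ (left_mem V)).1,
      (h _ (right_mem V)).2.trans_le (le_right W hj)⟩
  · rintro ⟨h1, h2⟩
    exact ⟨_, left_mem W, _, right_mem W, fun k hk =>
      ⟨h1.trans_le (left_le V hk), (le_right V hk).trans_lt h2⟩⟩

theorem leftCrosses_iff {V W : {V : Finset (Fin n) // V ∈ π.parts}} (hV : V.1.card = 2)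
    (hW : W.1.card = 2) :
    LeftCrosses W.1 V.1 ↔ left W < left V ∧ left V < right W ∧ right W < right V := by
  constructor
  · rintro ⟨i, hi, j, hj, k, hk, l, hl, h1, h2, h3⟩
    rw [mem_block_iff hV] at hi hj
    rw [mem_block_iff hW] at hk hl
    have := left_lt_right hV
    have := left_lt_right hW
    rcases hi with rfl | rfl <;> rcases hj with rfl | rfl <;> rcases hk with rfl | rfl <;>
      rcases hl with rfl | rfl <;> first | exact ⟨h1, h2, h3⟩ | (exfalso; order)
  · rintro ⟨h1, h2, h3⟩
    exact ⟨_, left_mem V, _, right_mem V, _, left_mem W, _, right_mem W, h1, h2, h3⟩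

end Blocks

theorem arcOf_injective (p : ColoredPartition n) : Function.Injective (arcOf p) := by
  intro V W h
  have h1 : left V = left W := congrArg Prod.fst h
  exact block_unique (left_mem V) (h1 ▸ left_mem W)

theorem arcs_injective {p p' : ColoredPartition n} (hp : IsPairing p) (hp' : IsPairing p')
    (h : arcs p = arcs p') : p = p' := by
  have key : ∀ {p p' : ColoredPartition n}, IsPairing p → IsPairing p' → arcs p = arcs p' →
      ∀ V, ∃ V' : {V : Finset (Fin n) // V ∈ p'.1.parts}, V'.1 = V.1 ∧ p'.2 V' = p.2 V := by
    intro p p' hp hp' h V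
    obtain ⟨V', hV'⟩ := mem_arcs.1 (h ▸ mem_arcs.2 ⟨V, rfl⟩ : arcOf p V ∈ arcs p')
    simp only [arcOf, Prod.mk.injEq] at hV'
    refine ⟨V', ?_, hV'.2.2⟩
    ext i
    rw [mem_block_iff (hp' _ V'.2), mem_block_iff (hp _ V.2), hV'.1, hV'.2.1]
  obtain ⟨π, f⟩ := p
  obtain ⟨π', f'⟩ := p'
  have hπ : π = π' := by
    ext V
    constructor
    · intro hV
      obtain ⟨V', e, -⟩ := key hp hp' h ⟨V, hV⟩
      exact (show V'.1 = V from e) ▸ V'.2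
    · intro hV
      obtain ⟨V', e, -⟩ := key hp' hp h.symm ⟨V, hV⟩
      exact (show V'.1 = V from e) ▸ V'.2
  subst hπ
  congr 1
  funext V
  obtain ⟨V', e, e'⟩ := key hp hp' h V
  obtain rfl : V' = V := Subtype.ext e
  exact e'.symm

/-- With `k = n` and `S = ∅` the arcs partition all points, and each block inherits the colour of
its arc. -/
theorem exists_arcs_eq {E : Fin n → Finset Bool} {b : ℤˣ} {M : Finset (Arc n)}
    (h : IsMatching E n ∅ b M) : ∃ p : ColoredPartition n, IsPairing p ∧ arcs p = M := by
  classical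
  set block : Arc n → Finset (Fin n) := fun a => {a.1, a.2.1} with hblock
  have hmem : ∀ a i, i ∈ block a ↔ i = a.1 ∨ i = a.2.1 := by simp [hblock]
  let π : SetPartition n := Finpartition.ofExistsUnique (M.image block)
    (fun _ _ => Finset.subset_univ _)
    (by
      intro i _
      obtain ⟨a, ha, hi⟩ := h.exists_arc i (Or.inl i.2)
      refine ⟨block a, ⟨Finset.mem_image_of_mem _ ha, (hmem _ _).2 hi⟩, ?_⟩
      rintro _ ⟨hV, hi'⟩
      obtain ⟨a', ha', rfl⟩ := Finset.mem_image.1 hV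
      rw [h.unique_arc a ha a' ha' i hi ((hmem _ _).1 hi')])
    (by
      intro h0
      obtain ⟨a, ha, e⟩ := Finset.mem_image.1 h0
      have : a.1 ∈ block a := (hmem _ _).2 (Or.inl rfl)
      rw [e] at this
      simp at this)
  have hπ : ∀ V, V ∈ π.parts ↔ ∃ a ∈ M, block a = V := fun V => Finset.mem_image
  choose g hgM hgV using fun V : {V : Finset (Fin n) // V ∈ π.parts} => (hπ V.1).1 V.2
  have hcard : ∀ a ∈ M, (block a).card = 2 := fun a ha => Finset.card_pair (h.lt a ha).ne
  let p : ColoredPartition n := ⟨π, fun V => (g V).2.2⟩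
  have hp : IsPairing p := by
    intro V hV
    obtain ⟨a, ha, rfl⟩ := (hπ V).1 hV
    exact hcard a ha
  have harc : ∀ V, arcOf p V = g V := by
    intro V
    have hlt := h.lt _ (hgM V)
    have hl := left_mem V
    have hr := right_mem V
    rw [← hgV V, hmem] at hl hr
    have hlr := left_lt_right (hp _ V.2)
    have h1 : left V = (g V).1 := by
      rcases hl with e | e
      · exact e
      · rcases hr with e' | e' <;> order
    have h2 : right V = (g V).2.1 := by
      rcases hr with e | e
      · rcases hl with e' | e' <;> order
      · exact e
    exact Prod.ext h1 (Prod.ext h2 rfl)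
  refine ⟨p, hp, ?_⟩
  ext a
  rw [mem_arcs]
  constructor
  · rintro ⟨V, rfl⟩
    rw [harc]
    exact hgM V
  · intro ha
    refine ⟨⟨block a, (hπ _).2 ⟨a, ha, rfl⟩⟩, ?_⟩
    rw [harc]
    refine h.unique_arc _ (hgM _) a ha a.1 ?_ (Or.inl rfl)
    rw [← hmem, hgV]
    exact (hmem _ _).2 (Or.inl rfl)

theorem card_filter_arcs (p : ColoredPartition n) (P : Arc n → Prop) [DecidablePred P]
    (Q : Finset (Fin n) → Prop) [DecidablePred Q] (h : ∀ V, P (arcOf p V) ↔ Q V.1) :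
    Finset.card {a ∈ arcs p | P a} = Finset.card {V ∈ p.1.parts | Q V} := by
  classical
  rw [arcs, Finset.filter_image, Finset.card_image_of_injective _ (arcOf_injective p)]
  simp only [h]
  rw [← Finset.card_map (Function.Embedding.subtype _)]
  congr 1
  ext V
  simp [and_comm]

/-- Summed over all blocks, these local exponents give `Cr + 2 cnp`. -/
theorem IsPairing.arcExp_arcOf {p : ColoredPartition n} (hp : IsPairing p)
    (V : {V : Finset (Fin n) // V ∈ p.1.parts}) :
    arcExp (arcs p) (arcOf p V) =
      lcr p.1 V + if p.2 V = -1 then 2 * cover p.1 V else 0 := by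
  classical
  rw [arcExp, lcr, cover]
  congr 1
  · exact card_filter_arcs p _ _ fun W => (leftCrosses_iff (hp _ V.2) (hp _ W.2)).symm
  · change (if p.2 V = -1 then _ else 0) = _
    congr 2
    exact card_filter_arcs p _ _ fun W => (covers_iff V W).symm

theorem IsPairing.pairs_eq {p : ColoredPartition n} (hp : IsPairing p) : pairs p.1 = p.1.parts :=
  Finset.filter_true_of_mem hp

theorem IsPairing.cnp_eq {p : ColoredPartition n} (hp : IsPairing p) :
    cnp p = ∑ V, if p.2 V = -1 then cover p.1 V.1 else 0 := by
  classical
  have h : negPairs p = ({V | p.2 V = -1} : Finset {V : Finset (Fin n) // V ∈ p.1.parts}) := by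
    ext V
    simp [negPairs, hp _ V.2]
  rw [cnp, Finset.card_filter, Finset.sum_product, h, Finset.sum_filter, hp.pairs_eq]
  refine Finset.sum_congr rfl fun V _ => ?_
  rw [cover, Finset.card_filter]

theorem IsPairing.matchWeight_arcs (q : ℝ) (bar : H →L[ℂ] H) (x : Fin n → H)
    {p : ColoredPartition n} (hp : IsPairing p) :
    matchWeight q bar x (arcs p) = weight q bar x p := by
  classical
  have h1 : matchWeight q bar x (arcs p) = ∏ V, ((q : ℂ) ^ arcExp (arcs p) (arcOf p V) *
      inner ℂ (x (left V)) (twist bar (p.2 V) (x (right V)))) := by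
    rw [matchWeight]
    conv_lhs => rw [arcs]
    rw [Finset.prod_image fun V _ W _ e => arcOf_injective p e]
    rfl
  have h2 : ∑ V, arcExp (arcs p) (arcOf p V) = Cr p.1 + 2 * cnp p := by
    simp only [hp.arcExp_arcOf, Finset.sum_add_distrib, hp.cnp_eq, Finset.mul_sum, mul_ite,
      mul_zero]
    congr 1
    rw [Cr, ← Finset.sum_coe_sort p.1.parts]
  rw [h1, Finset.prod_mul_distrib, Finset.prod_pow_eq_pow_sum, h2, weight, mul_assoc]
  congr 1
  have h3 : ({V | p.2 V = -1} : Finset {V : Finset (Fin n) // V ∈ p.1.parts}) =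
      ({V | ¬ p.2 V = 1} : Finset {V : Finset (Fin n) // V ∈ p.1.parts}) := by
    ext V
    simp only [Finset.mem_filter, Finset.mem_univ, true_and]
    rcases Int.units_eq_one_or (p.2 V) with h | h <;> rw [h] <;> decide
  have h4 : ∀ V, p.2 V = -1 → inner ℂ (x (left V)) (twist bar (p.2 V) (x (right V))) =
      inner ℂ (x (left V)) (bar (x (right V))) := fun V hV => by rw [hV, twist_neg_one]
  rw [← Finset.prod_filter_mul_prod_filter_not Finset.univ (fun V => p.2 V = 1), ← h3]
  congr 1
  · refine Finset.prod_congr rfl fun V hV => ?_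
    rw [(Finset.mem_filter.1 hV).2, twist_one]
  · exact Finset.prod_congr rfl fun V hV => h4 V (Finset.mem_filter.1 hV).2

theorem IsPairing.rightSign_arcs {p : ColoredPartition n} (hp : IsPairing p)
    (V : {V : Finset (Fin n) // V ∈ p.1.parts}) :
    rightSign (arcs p) (left V) = (-1) ^ npr p V.1 := by
  classical
  rw [rightSign, arcs, Finset.filter_image,
    Finset.prod_image fun V _ W _ e => arcOf_injective p e, npr]
  have h : ({W ∈ negPairs p | RightOf W.1 V.1} : Finset _) =
      ({W ∈ ({W | left V < (arcOf p W).1} : Finset _) | p.2 W = -1} : Finset _) := by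
    ext W
    rw [Finset.mem_filter, Finset.mem_filter, Finset.mem_filter, negPairs, Finset.mem_filter,
      rightOf_iff]
    simp only [Finset.mem_univ, true_and, hp _ W.2]
    exact and_comm
  rw [h, ← Finset.prod_const]
  refine Eq.trans ?_ (Finset.prod_filter _ _).symm
  refine Finset.prod_congr rfl fun W _ => ?_
  change p.2 W = _
  split_ifs with h
  · exact h
  · exact (Int.units_eq_one_or _).resolve_right h

/-- An arc passing over the left end of `V` crosses or covers `V` according to whether it ends
before or after `V`. -/
theorem IsPairing.free_iff {p : ColoredPartition n} (hp : IsPairing p)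
    (V : {V : Finset (Fin n) // V ∈ p.1.parts}) :
    (∀ a ∈ arcs p, ¬ (a.1 < left V ∧ left V < a.2.1)) ↔ lcr p.1 V = 0 ∧ cover p.1 V = 0 := by
  classical
  rw [lcr, cover, Finset.card_eq_zero, Finset.card_eq_zero, Finset.filter_eq_empty_iff,
    Finset.filter_eq_empty_iff]
  constructor
  · intro h
    refine ⟨fun W hW hc => ?_, fun W hW hc => ?_⟩
    · have := (leftCrosses_iff (W := ⟨W, hW⟩) (hp _ V.2) (hp _ hW)).1 hc
      exact h _ (mem_arcs.2 ⟨⟨W, hW⟩, rfl⟩) ⟨this.1, this.2.1⟩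
    · have := (covers_iff V ⟨W, hW⟩).1 hc
      exact h _ (mem_arcs.2 ⟨⟨W, hW⟩, rfl⟩)
        ⟨this.1, (left_lt_right (hp _ V.2)).trans this.2⟩
  · rintro ⟨h1, h2⟩ a ha ⟨h3, h4⟩
    obtain ⟨W, rfl⟩ := mem_arcs.1 ha
    rcases lt_trichotomy (right W) (right V) with h | h | h
    · exact h1 W.2 ((leftCrosses_iff (hp _ V.2) (hp _ W.2)).2 ⟨h3, h4, h⟩)
    · have : W = V := block_unique (right_mem W) (h ▸ right_mem V)
      rw [this] at h3
      exact lt_irrefl _ h3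
    · exact h2 W.2 ((covers_iff V W).2 ⟨h3, h⟩)

/-- A pairing has no singletons, so `sr` vanishes and the two singleton clauses of `IsTypeD` are
empty; the colour of a free pair is the only remaining constraint. -/
theorem IsPairing.isMatching_arcs_iff {E : Fin n → Finset Bool} {p : ColoredPartition n}
    (hp : IsPairing p) : IsMatching E n ∅ 1 (arcs p) ↔
      IsTypeD p ∧ ∀ V : {V : Finset (Fin n) // V ∈ p.1.parts},
        false ∈ E (left V) ∧ true ∈ E (right V) := by
  have hsing : sing p.1 = ∅ :=
    Finset.filter_eq_empty_iff.2 fun V hV h => by rw [hp V hV] at h; omega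
  constructor
  · intro h
    refine ⟨⟨fun V hV => Or.inr (hp V hV), fun V _ _ h1 h2 => ?_, fun V hV => ?_, fun V hV => ?_⟩,
      fun V => ⟨h.left_allowed _ (mem_arcs.2 ⟨V, rfl⟩), h.right_allowed _ (mem_arcs.2 ⟨V, rfl⟩)⟩⟩
    · have := h.color _ (mem_arcs.2 ⟨V, rfl⟩) ((hp.free_iff V).2 ⟨h1, h2⟩)
      rw [one_mul] at this
      rw [← hp.rightSign_arcs]
      exact this
    · rw [hp _ V.2] at hV; omega
    · rw [hp _ V.2] at hV; omega
  · rintro ⟨h, hE⟩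
    constructor
    · exact fun a _ => a.1.2
    · intro a ha
      obtain ⟨V, rfl⟩ := mem_arcs.1 ha
      exact left_lt_right (hp _ V.2)
    · exact fun a _ => Or.inl a.2.1.2
    · intro a ha
      obtain ⟨V, rfl⟩ := mem_arcs.1 ha
      exact (hE V).1
    · intro a ha
      obtain ⟨V, rfl⟩ := mem_arcs.1 ha
      exact (hE V).2
    · intro i _
      obtain ⟨V, hV, hi⟩ := p.1.exists_mem (Finset.mem_univ i)
      exact ⟨_, mem_arcs.2 ⟨⟨V, hV⟩, rfl⟩, (mem_block_iff (V := ⟨V, hV⟩) (hp _ hV) i).1 hi⟩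
    · intro a ha a' ha' i hi hi'
      obtain ⟨V, rfl⟩ := mem_arcs.1 ha
      obtain ⟨V', rfl⟩ := mem_arcs.1 ha'
      rw [block_unique ((mem_block_iff (hp _ V.2) i).2 hi) ((mem_block_iff (hp _ V'.2) i).2 hi')]
    · intro a ha hfree
      obtain ⟨V, rfl⟩ := mem_arcs.1 ha
      obtain ⟨h1, h2⟩ := (hp.free_iff V).1 hfree
      rw [one_mul]
      refine Eq.trans ?_ (hp.rightSign_arcs V).symm
      exact h.color_pair V (hp _ V.2) (by simp [sr, hsing]) h1 h2

theorem sum_matchings_eq (q : ℝ) (bar : H →L[ℂ] H) (x : Fin n → H) (E : Fin n → Finset Bool)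
    (s : Finset (ColoredPartition n))
    (hs : ∀ p, p ∈ s ↔ IsPairing p ∧ IsMatching E n ∅ 1 (arcs p)) :
    ∑ M ∈ matchings E n ∅ 1, matchWeight q bar x M = ∑ p ∈ s, weight q bar x p := by
  symm
  refine Finset.sum_bij (fun p _ => arcs p) ?_ ?_ ?_ ?_
  · intro p hp
    exact mem_matchings.2 ((hs p).1 hp).2
  · intro p hp p' hp' h
    exact arcs_injective ((hs p).1 hp).1 ((hs p').1 hp').1 h
  · intro M hM
    obtain ⟨p, hp, rfl⟩ := exists_arcs_eq (mem_matchings.1 hM)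
    exact ⟨p, (hs p).2 ⟨hp, mem_matchings.1 hM⟩, rfl⟩
  · intro p hp
    exact (((hs p).1 hp).1.matchWeight_arcs q bar x).symm

theorem mem_PD2_iff {p : ColoredPartition n} :
    p ∈ PD2 n ↔ IsPairing p ∧ IsMatching (fun _ => Finset.univ) n ∅ 1 (arcs p) := by
  have h : p ∈ PD2 n ↔ IsTypeD p ∧ IsPairing p := by simp [PD2, IsPairing]
  rw [h, and_comm]
  refine and_congr_right fun hp => ?_
  rw [hp.isMatching_arcs_iff]
  simp

theorem mem_PD2eps_iff {ε : Fin n → Bool} {p : ColoredPartition n} :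
    p ∈ PD2eps ε ↔ IsPairing p ∧ IsMatching (fun i => {ε i}) n ∅ 1 (arcs p) := by
  have h : p ∈ PD2eps ε ↔ IsPairing p ∧ IsTypeD p ∧ Compatible ε p.1 := by
    simp only [PD2eps, PD2, IsPairing, Finset.mem_filter, Finset.mem_univ, true_and]
    tauto
  rw [h]
  refine and_congr_right fun hp => ?_
  rw [hp.isMatching_arcs_iff]
  refine and_congr_right fun _ => ?_
  simp only [Finset.mem_singleton]
  constructor
  · rintro ⟨h1, -⟩ V
    have hV : ({left V, right V} : Finset (Fin n)) = V.1 := by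
      ext i
      rw [mem_block_iff (hp _ V.2)]
      simp
    have := h1 (left V) (right V) (left_lt_right (hp _ V.2)) (hV ▸ V.2)
    exact ⟨this.1.symm, this.2.symm⟩
  · intro h1
    refine ⟨fun i j hij hV => ?_, fun i hV => ?_⟩
    · have h2 := h1 ⟨_, hV⟩
      have hl : left (⟨_, hV⟩ : {V : Finset (Fin n) // V ∈ p.1.parts}) = i := by
        have h3 := left_le ⟨_, hV⟩ (Finset.mem_insert_self i {j})
        have h4 := left_mem ⟨_, hV⟩
        simp only [Finset.mem_insert, Finset.mem_singleton] at h4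
        rcases h4 with h4 | h4
        · exact h4
        · order
      have hr : right (⟨_, hV⟩ : {V : Finset (Fin n) // V ∈ p.1.parts}) = j := by
        have h3 := le_right ⟨_, hV⟩ (show j ∈ ({i, j} : Finset (Fin n)) by simp)
        have h4 := right_mem ⟨_, hV⟩
        simp only [Finset.mem_insert, Finset.mem_singleton] at h4
        rcases h4 with h4 | h4
        · order
        · exact h4
      rw [hl, hr] at h2
      exact ⟨h2.1.symm, h2.2.symm⟩
    · have := hp _ hV
      simp at this

end TypeD

end

theorem theorem3p8 {H : Type*} [NormedAddCommGroup H] [InnerProductSpace ℂ H] [CompleteSpace H]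
    (bar : H →L[ℂ] H) (hbar_sa : IsSelfAdjoint bar) (hbar_inv : ∀ y, bar (bar y) = y)
    (q : ℝ) (hq₁ : -1 < q) (hq₂ : q < 1) (n : ℕ) (x : Fin n → H) (ε : Fin n → Bool) :
    (∀ y : H, TypeD.IsAdjointQ q bar (TypeD.annihilation q bar y) (TypeD.creation y)) ∧
    TypeD.innerQ q bar (TypeD.vacuum H)
        ((List.ofFn fun i => TypeD.dOp q bar (ε i) (x i)).prod (TypeD.vacuum H)) =
      ∑ p ∈ TypeD.PD2eps ε, TypeD.weight q bar x p ∧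
    TypeD.innerQ q bar (TypeD.vacuum H)
        ((List.ofFn fun i => TypeD.gaussian q bar (x i)).prod (TypeD.vacuum H)) =
      ∑ p ∈ TypeD.PD2 n, TypeD.weight q bar x p := by
  have hsym : ∀ x y, inner ℂ (bar x) y = inner ℂ x (bar y) := fun x y =>
    hbar_sa.isSymmetric x y
  refine ⟨TypeD.isAdjointQ_annihilation q hsym hbar_inv, ?_, ?_⟩
  -- Here `E i = {ε i}`, so that `opSum` is the single operator `dOp`.
  · rw [← TypeD.sum_matchings_eq q bar x _ _ fun _ => TypeD.mem_PD2eps_iff,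
      ← TypeD.moment_eq_sum_matchings q hbar_inv hsym]
    simp only [TypeD.opSum, Finset.sum_singleton]
    rfl
  -- Here `E i` is everything, so that `opSum` is the Gaussian operator.
  · rw [← TypeD.sum_matchings_eq q bar x _ _ fun _ => TypeD.mem_PD2_iff,
      ← TypeD.moment_eq_sum_matchings q hbar_inv hsym]
    simp only [TypeD.opSum, Fintype.sum_bool, TypeD.gaussian, add_comm (TypeD.annihilation _ _ _)]
    rfl
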